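/- Languages are subsets of $\{0,1\}^*$, and $\chi_A$ is the characteristic function of $A$. Let $\mathrm{BH}_1=\mathrm{NP}$ and, for $k>1$, $\mathrm{BH}_k=\{A\setminus B : A\in\mathrm{NP},\ B\in\mathrm{BH}_{k-1}\}$. For classes $\mathcal C_1,\mathcal C_2$ of languages, let $\mathrm P^{\mathcal C_1[1]:\mathcal C_2[1]}$ be the class of languages accepted by deterministic polynomial-time oracle machines that on every input make one query to an oracle from $\mathcal C_1$ followed by one query to an oracle from $\mathcal C_2$, and let $\mathrm P^{\mathcal C_1[1]:\mathcal C_2[1]_+}$ be the class of languages accepted by such machines that moreover accept if and only if the second query is answered "yes". For a class $\mathcal C$, let $\mathrm R^p_{1\text{-tt}}(\mathcal C)$ be the class of all languages $A$ for which there are a language $C\in\mathcal C$ and a polynomial-time computable function that maps each $x$ to a string $q_x$ and a Boolean predicate $\alpha_x$ of one variable such that $x\in A\iff\alpha_x(\chi_C(q_x))$. Let $j,k\ge 1$ be integers, where $j\geq 2$ in case $j$ is odd and $k$ is even (so that $\mathrm{BH}_{j-1}$ is defined). Then $$\mathrm R^p_{1\text{-tt}}\bigl(\mathrm P^{\mathrm{BH}_j[1]:\mathrm{BH}_k[1]_+}\bigr)=\begin{cases}\mathrm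 P^{\mathrm{BH}_{j-1}[1]:\mathrm{BH}_k[1]} & \text{if } j \text{ is odd and } k \text{ is even},\\ \mathrm P^{\mathrm{BH}_j[1]:\mathrm{BH}_k[1]} & \text{otherwise.}\end{cases}$$ -/

import Mathlib

namespace QueryOrder

/-- A language: a set of binary strings. -/
abbrev Lang : Type := Set (List Bool)

/-- The characteristic function of a language. -/
noncomputable def chi (L : Lang) (x : List Bool) : Bool :=
  open scoped Classical in decide (x ∈ L)

/-- `f` is computable by a (multi-stack) Turing machine in time polynomial in the length of the
encoded input. -/
def PolyTime {α β αΓ βΓ : Type} (ea : α → List αΓ) (eb : β → List βΓ) (f : α → β) : Prop :=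
  Nonempty (Turing.TM2ComputableInPolyTime ea eb f)

/-! ### NP and the boolean hierarchy -/

/-- A pair of binary strings, written as `x#y` over the alphabet `{0, 1, #}` (`#` is `none`). -/
def encPair (p : List Bool × List Bool) : List (Option Bool) :=
  p.1.map some ++ none :: p.2.map some

/-- NP: membership has certificates of polynomial length, verifiable in polynomial time. -/
def NP : Set Lang :=
  {L | ∃ (p : Polynomial ℕ) (V : List Bool × List Bool → Bool),
    PolyTime encPair Computability.encodeBool V ∧
    ∀ x, x ∈ L ↔ ∃ w : List Bool, w.length ≤ p.eval x.length ∧ V (x, w) = true}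

/-- `C₁ ⊖ C₂ = {A - B : A ∈ C₁, B ∈ C₂}`. -/
def classDiff (C₁ C₂ : Set Lang) : Set Lang :=
  {L | ∃ A ∈ C₁, ∃ B ∈ C₂, L = A \ B}

/-- The levels of the boolean hierarchy, `BH 1 = NP` and `BH k = NP ⊖ BH (k - 1)` for `k > 1`.
The hierarchy starts at level `1`; the value at `0` is only a placeholder. -/
def BH : ℕ → Set Lang
  | 0 => {∅}
  | 1 => NP
  | k + 2 => classDiff NP (BH (k + 1))

/-! ### Truth-table reductions with one query -/

/-- Encoding of a query string together with a unary boolean predicate, the latter being given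
by its truth table. -/
def encTT (r : List Bool × (Bool → Bool)) : List Bool :=
  r.2 false :: r.2 true :: r.1

/-- `A` is polynomial-time 1-truth-table reducible to `B`. -/
def OneTTReducible (A B : Lang) : Prop :=
  ∃ f : List Bool → List Bool × (Bool → Bool),
    PolyTime id encTT f ∧ ∀ x, x ∈ A ↔ (f x).2 (chi B (f x).1) = true

/-- `R^p_{1-tt}(C)`: the languages that are 1-truth-table reducible to a member of `C`. -/
def R1tt (C : Set Lang) : Set Lang :=
  {L | ∃ B ∈ C, OneTTReducible L B}

/-! ### Oracle machines with two sequential queries -/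

/-- A deterministic oracle machine. The output stack `tm.k₁` of the underlying (multi-stack)
Turing machine serves as the query stack. When control reaches the label `query`, the oracle is
asked about the string on the query stack, this stack is erased, and control passes to
`answer true` or `answer false` according to the answer. The statement which `tm` holds at
`query` is never executed. When the machine halts, `accept` reads the verdict off its internal
state. -/
structure OracleTM extends Turing.TM2ComputableAux Bool Bool where
  query : tm.Λ
  answer : Bool → tm.Λ
  accept : tm.σ → Bool

namespace OracleTM

variable (M : OracleTM)

/-- A configuration: a configuration of the underlying machine, and the list of the answers
received so far, in chronological order. -/
abbrev Cfg : Type := M.tm.Cfg × List Bool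

/-- The initial configuration on input `x`. -/
def init (x : List Bool) : M.Cfg :=
  (Turing.initList M.tm (x.map M.inputAlphabet.symm), [])

/-- The string currently on the query stack. -/
def queryString (c : M.tm.Cfg) : List Bool :=
  (c.stk M.tm.k₁).map M.outputAlphabet

/-- One step of the machine, where the first query is answered by `A` and the others by `B`. -/
noncomputable def step (A B : Lang) (c : M.Cfg) : Option M.Cfg :=
  open scoped Classical in
  if c.1.l = some M.query then
    let b := chi (if c.2 = [] then A else B) (M.queryString c.1)
    some (⟨some (M.answer b), c.1.var, Function.update c.1.stk M.tm.k₁ []⟩, c.2 ++ [b])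
  else
    (M.tm.step c.1).map fun c' => (c', c.2)

/-- With oracles `A`, then `B`, the machine on input `x` reaches the halting configuration `c`
within `t` steps. -/
def HaltsWithin (A B : Lang) (x : List Bool) (c : M.Cfg) (t : ℕ) : Prop :=
  Nonempty (StateTransition.EvalsToInTime (M.step A B) (M.init x) (some c) t) ∧ c.1.l = none

/-- With oracles `A`, then `B`, the machine on input `x` halts in the configuration `c`. -/
def HaltsAt (A B : Lang) (x : List Bool) (c : M.Cfg) : Prop :=
  ∃ t, M.HaltsWithin A B x c t

/-- The machine runs in polynomial time, uniformly in the oracles, and on every input it makes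
one query to the first oracle followed by one query to the second oracle. -/
def IsPolyTwoQuery : Prop :=
  ∃ p : Polynomial ℕ, ∀ (A B : Lang) (x : List Bool),
    ∃ (c : M.Cfg) (a b : Bool), M.HaltsWithin A B x c (p.eval x.length) ∧ c.2 = [a, b]

/-- The language accepted with oracles `A`, then `B`. -/
def language (A B : Lang) : Lang :=
  {x | ∃ c, M.HaltsAt A B x c ∧ M.accept c.1.var = true}

/-- The machine accepts if and only if its second query is answered "yes". -/
def AcceptsIffSecondYes : Prop :=
  ∀ (A B : Lang) (x : List Bool) (c : M.Cfg), M.HaltsAt A B x c →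
    (M.accept c.1.var = true ↔ c.2[1]? = some true)

end OracleTM

/-- `P^{C₁[1]:C₂[1]}`: the languages accepted by polynomial-time machines making one query to a
`C₁` oracle followed by one query to a `C₂` oracle. -/
def PQuery (C₁ C₂ : Set Lang) : Set Lang :=
  {L | ∃ M : OracleTM, M.IsPolyTwoQuery ∧ ∃ A ∈ C₁, ∃ B ∈ C₂, L = M.language A B}

/-- `P^{C₁[1]:C₂[1]_+}`: as `PQuery C₁ C₂`, but only with machines that accept if and only if
the second query is answered "yes". -/
def PQueryPlus (C₁ C₂ : Set Lang) : Set Lang :=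
  {L | ∃ M : OracleTM, M.IsPolyTwoQuery ∧ M.AcceptsIffSecondYes ∧
    ∃ A ∈ C₁, ∃ B ∈ C₂, L = M.language A B}

end QueryOrder

/-! A language is in `BH k` iff it has the form `{x | Odd (c x)}` for a counter `c ≤ k` whose
superlevel sets are all in NP (`mem_BH_iff`); the counter may be pictured as growing while witnesses
are found. A two-query computation on `x` is governed by three such counters: one, at most `j`, for
the first query, and two, at most `k` each, for the second query after the first answer "no" or
"yes". While they grow from zero, the verdict changes at most `j + 2 * k` times, and the longest
alternating chain below the true position of `x` is itself a counter of the above kind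
(`mem_BH_of_mindChanges`, `mem_BH_of_two_queries`).

If the verdict is the second answer, it has the parity of `k` at the top position `(j, k, k)`,
whereas `j + 2 * k` changes starting from rejection would give the parity of `j`. So one change is
lost when `j + k` is odd, which leaves `changes j k`. An explicit monotone path through the
positions attains this number (`exists_path`). Hence `PQueryPlus (BH j) (BH k) = BH (changes j k)`.

For arbitrary verdicts, compare with the verdict for two negative answers: it is computable in
polynomial time, so a 1-tt reduction can add it. Again there are at most `j + 2 * k` changes, and
all of them can occur only if the answers (no, yes) and (no, no) give different verdicts. If `j` is
even and `k` is odd, the top position has the answers (no, yes), so its verdict differs from the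
initial one, while an even number of changes would restore it: one change is lost, as before. If `j
+ k` is even, nothing needs to be lost. Therefore `R1tt (BH (changes j k)) = PQuery (BH j) (BH k)`
unless `j` is odd and `k` is even. In that case `changes j k = changes (j - 1) k`, and the pair `(j
- 1, k)` is not exceptional.

The machine-level half of the proof supplies what this argument takes for granted: closure
properties of polynomial-time functions and of NP, the translation of an oracle machine into query
functions and a verdict table (`OracleTM.exists_functions`), and a machine asking two prescribed
queries (`OracleTM.exists_twoQuery`). -/

namespace QueryOrder

open Turing

/-! ### Flowcharts: single-entry, single-exit pieces of stack programs -/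

/-- The contents of a family of stacks. -/
abbrev Stk {K : Type} (Γ : K → Type) : Type := ∀ k, List (Γ k)

/-- A flowchart over stacks `Γ` and internal states `σ`. Jumping to `none`, or halting, leaves the
flowchart through its exit. -/
structure Flow {K : Type} (Γ : K → Type) (σ : Type) where
  /-- the labels -/
  Λ : Type
  [fin : Fintype Λ]
  /-- the entry label -/
  entry : Λ
  /-- the statement at each label -/
  code : Λ → TM2.Stmt Γ (Option Λ) σ

attribute [instance] Flow.fin

/-- Redirect the jumps of a statement with exits. -/
def mapLabel {K : Type} {Γ : K → Type} {σ Λ Λ' : Type} (φ : Option Λ → Option Λ') :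
    TM2.Stmt Γ (Option Λ) σ → TM2.Stmt Γ (Option Λ') σ
  | .push k f q => .push k f (mapLabel φ q)
  | .peek k f q => .peek k f (mapLabel φ q)
  | .pop k f q => .pop k f (mapLabel φ q)
  | .load f q => .load f (mapLabel φ q)
  | .branch f q₁ q₂ => .branch f (mapLabel φ q₁) (mapLabel φ q₂)
  | .goto f => .goto fun v => φ (f v)
  | .halt => .goto fun _ => φ none

/-- Turn a statement with exits into an ordinary statement, where `φ` tells what to do with the
jumps and exits (`none` means to halt) and `d` is an irrelevant default. -/
def toStmt {K : Type} {Γ : K → Type} {σ Λ Λ' : Type} (φ : Option Λ → Option Λ') (d : Λ') :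
    TM2.Stmt Γ (Option Λ) σ → TM2.Stmt Γ Λ' σ
  | .push k f q => .push k f (toStmt φ d q)
  | .peek k f q => .peek k f (toStmt φ d q)
  | .pop k f q => .pop k f (toStmt φ d q)
  | .load f q => .load f (toStmt φ d q)
  | .branch f q₁ q₂ => .branch f (toStmt φ d q₁) (toStmt φ d q₂)
  | .goto f => .branch (fun v => (φ (f v)).isSome) (.goto fun v => (φ (f v)).getD d) .halt
  | .halt => .branch (fun _ => (φ none).isSome) (.goto fun _ => (φ none).getD d) .halt

/-- Turn the jumps of an ordinary statement into jumps with exits; halting becomes the exit. -/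
def ofStmt {K : Type} {Γ : K → Type} {σ Λ Λ' : Type} (φ : Λ → Option Λ') :
    TM2.Stmt Γ Λ σ → TM2.Stmt Γ (Option Λ') σ
  | .push k f q => .push k f (ofStmt φ q)
  | .peek k f q => .peek k f (ofStmt φ q)
  | .pop k f q => .pop k f (ofStmt φ q)
  | .load f q => .load f (ofStmt φ q)
  | .branch f q₁ q₂ => .branch f (ofStmt φ q₁) (ofStmt φ q₂)
  | .goto f => .goto fun v => φ (f v)
  | .halt => .halt

/-- A component `τ` of the internal state `σ`. -/
structure Part (σ τ : Type) where
  /-- read the component -/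
  get : σ → τ
  /-- write the component -/
  set : τ → σ → σ
  get_set : ∀ a v, get (set a v) = a
  set_get : ∀ v, set (get v) v = v
  set_set : ∀ a b v, set a (set b v) = set a v

/-- Let a statement act on some of the stacks, and on a component of the internal state. -/
def liftStmt {K K' : Type} {Γ : K → Type} {σ τ Λ : Type} (e : K' → K) (π : Part σ τ) :
    TM2.Stmt (fun k => Γ (e k)) Λ τ → TM2.Stmt Γ Λ σ
  | .push k f q => .push (e k) (fun v => f (π.get v)) (liftStmt e π q)
  | .peek k f q => .peek (e k) (fun v o => π.set (f (π.get v) o) v) (liftStmt e π q)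
  | .pop k f q => .pop (e k) (fun v o => π.set (f (π.get v) o) v) (liftStmt e π q)
  | .load f q => .load (fun v => π.set (f (π.get v)) v) (liftStmt e π q)
  | .branch f q₁ q₂ => .branch (fun v => f (π.get v)) (liftStmt e π q₁) (liftStmt e π q₂)
  | .goto f => .goto fun v => f (π.get v)
  | .halt => .halt

section Stmt

variable {K : Type} [DecidableEq K] {Γ : K → Type} {σ Λ Λ' : Type}

/-- Halting (`l = none`) and jumping to the exit (`l = some none`) both mean leaving; `join`
identifies them. -/
theorem stepAux_mapLabel (φ : Option Λ → Option Λ') (q : TM2.Stmt Γ (Option Λ) σ) (v : σ)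
    (S : Stk Γ) :
    TM2.stepAux (mapLabel φ q) v S =
      ⟨some (φ (TM2.stepAux q v S).l.join), (TM2.stepAux q v S).var,
        (TM2.stepAux q v S).stk⟩ := by
  induction q generalizing v S with
  | branch f q₁ q₂ h₁ h₂ => cases h : f v <;> simp [mapLabel, TM2.stepAux, h, h₁, h₂]
  | goto f => simp [mapLabel, TM2.stepAux]
  | halt => simp [mapLabel, TM2.stepAux]
  | _ => simp_all [mapLabel, TM2.stepAux]

theorem stepAux_toStmt (φ : Option Λ → Option Λ') (d : Λ') (q : TM2.Stmt Γ (Option Λ) σ) (v : σ)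
    (S : Stk Γ) :
    TM2.stepAux (toStmt φ d q) v S =
      ⟨φ (TM2.stepAux q v S).l.join, (TM2.stepAux q v S).var, (TM2.stepAux q v S).stk⟩ := by
  induction q generalizing v S with
  | branch f q₁ q₂ h₁ h₂ => cases h : f v <;> simp [toStmt, TM2.stepAux, h, h₁, h₂]
  | goto f => cases h : φ (f v) <;> simp [toStmt, TM2.stepAux, h]
  | halt => cases h : φ none <;> simp [toStmt, TM2.stepAux, h]
  | _ => simp_all [toStmt, TM2.stepAux]

theorem stepAux_ofStmt (φ : Λ → Option Λ') (q : TM2.Stmt Γ Λ σ) (v : σ) (S : Stk Γ) :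
    TM2.stepAux (ofStmt φ q) v S =
      ⟨(TM2.stepAux q v S).l.map φ, (TM2.stepAux q v S).var, (TM2.stepAux q v S).stk⟩ := by
  induction q generalizing v S with
  | branch f q₁ q₂ h₁ h₂ => cases h : f v <;> simp [ofStmt, TM2.stepAux, h, h₁, h₂]
  | goto f => simp [ofStmt, TM2.stepAux]
  | halt => simp [ofStmt, TM2.stepAux]
  | _ => simp_all [ofStmt, TM2.stepAux]

/-- A frame rule: injectivity of `e` keeps distinct stacks apart, the laws of `Part` let successive
writes to the component collapse into one, and stacks outside the range of `e` are untouched. -/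
theorem stepAux_liftStmt {K' τ : Type} [DecidableEq K'] {e : K' → K} (he : e.Injective)
    (π : Part σ τ) (q : TM2.Stmt (fun k => Γ (e k)) Λ τ) (v : σ) (S : Stk Γ)
    (T : Stk fun k => Γ (e k))
    (hT : ∀ k, S (e k) = T k) :
    (TM2.stepAux (liftStmt e π q) v S).l = (TM2.stepAux q (π.get v) T).l ∧
    (TM2.stepAux (liftStmt e π q) v S).var = π.set (TM2.stepAux q (π.get v) T).var v ∧
    (∀ k, (TM2.stepAux (liftStmt e π q) v S).stk (e k) = (TM2.stepAux q (π.get v) T).stk k) ∧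
    ∀ k, (∀ k', e k' ≠ k) → (TM2.stepAux (liftStmt e π q) v S).stk k = S k := by
  have hupd : ∀ (T : Stk fun k => Γ (e k)) (S : Stk Γ) (hT : ∀ k, S (e k) = T k) (k : K') y k',
      Function.update S (e k) y (e k') = Function.update T k y k' := by
    intro T S hT k y k'
    by_cases h : k' = k
    · subst h; simp
    · rw [Function.update_of_ne h, Function.update_of_ne (fun h' => h (he h')), hT]
  induction q generalizing v S T with
  | push k f q ih =>
    obtain ⟨h1, h2, h3, h4⟩ := ih v (Function.update S (e k) (f (π.get v) :: S (e k)))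
      (Function.update T k (f (π.get v) :: T k)) (fun k' => by rw [hT k]; exact hupd T S hT k _ k')
    refine ⟨h1, h2, h3, fun k' hk' => ?_⟩
    rw [← Function.update_of_ne (hk' k).symm (f (π.get v) :: S (e k)) S]
    exact h4 k' hk'
  | peek k f q ih =>
    obtain ⟨h1, h2, h3, h4⟩ := ih (π.set (f (π.get v) (T k).head?) v) S T hT
    simp only [π.get_set, π.set_set] at h1 h2 h3 h4
    simp only [liftStmt, TM2.stepAux, hT]
    exact ⟨h1, h2, h3, h4⟩
  | pop k f q ih =>
    obtain ⟨h1, h2, h3, h4⟩ := ih (π.set (f (π.get v) (T k).head?) v)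
      (Function.update S (e k) (T k).tail) (Function.update T k (T k).tail)
      (fun k' => hupd T S hT k _ k')
    simp only [π.get_set, π.set_set] at h1 h2 h3 h4
    simp only [liftStmt, TM2.stepAux, hT]
    refine ⟨h1, h2, h3, fun k' hk' => ?_⟩
    rw [h4 k' hk', Function.update_of_ne (hk' k).symm]
  | load f q ih =>
    obtain ⟨h1, h2, h3, h4⟩ := ih (π.set (f (π.get v)) v) S T hT
    simp only [π.get_set, π.set_set] at h1 h2 h3 h4
    exact ⟨h1, h2, h3, h4⟩
  | branch f q₁ q₂ h₁ h₂ =>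
    cases h : f (π.get v)
    · simpa [liftStmt, TM2.stepAux, h] using h₂ v S T hT
    · simpa [liftStmt, TM2.stepAux, h] using h₁ v S T hT
  | goto f => simpa [liftStmt, TM2.stepAux, π.set_get] using hT
  | halt => simpa [liftStmt, TM2.stepAux, π.set_get] using hT

/-- An upper bound for the number of symbols that a statement pushes. -/
def pushes : TM2.Stmt Γ Λ σ → ℕ
  | .push _ _ q => pushes q + 1
  | .peek _ _ q => pushes q
  | .pop _ _ q => pushes q
  | .load _ q => pushes q
  | .branch _ q₁ q₂ => pushes q₁ + pushes q₂
  | .goto _ => 0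
  | .halt => 0

theorem length_stepAux_le (q : TM2.Stmt Γ Λ σ) (v : σ) (S : Stk Γ) (k : K) :
    ((TM2.stepAux q v S).stk k).length ≤ (S k).length + pushes q := by
  induction q generalizing v S with
  | push k' f q ih =>
    refine (ih v _).trans ?_
    by_cases h : k = k'
    · subst h; simp [pushes]; omega
    · simp [pushes, h]
  | peek k' f q ih => exact ih _ _
  | pop k' f q ih =>
    refine (ih _ _).trans ?_
    by_cases h : k = k'
    · subst h; simp [pushes]
    · simp [pushes, h]
  | load f q ih => exact ih _ _
  | branch f q₁ q₂ h₁ h₂ =>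
    have := h₁ v S
    have := h₂ v S
    cases h : f v <;> simp [pushes, TM2.stepAux, h] <;> omega
  | goto f => simp [TM2.stepAux, pushes]
  | halt => simp [TM2.stepAux, pushes]

end Stmt

namespace Flow

section Reach

variable {K : Type} [DecidableEq K] {Γ : K → Type} {σ : Type}

/-- One step of a flowchart. -/
def next (P : Flow Γ σ) (l : P.Λ) (v : σ) (S : Stk Γ) : Option P.Λ × σ × Stk Γ :=
  ((TM2.stepAux (P.code l) v S).l.join, (TM2.stepAux (P.code l) v S).var,
    (TM2.stepAux (P.code l) v S).stk)

/-- `P.Reach l v S n v' S'`: started at label `l`, the flowchart is left after exactly `n` steps,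
with state `v'` and stacks `S'`. -/
inductive Reach (P : Flow Γ σ) : P.Λ → σ → Stk Γ → ℕ → σ → Stk Γ → Prop
  | exit {l v S v' S'} (h : P.next l v S = (none, v', S')) : Reach P l v S 1 v' S'
  | step {l v S l' v₁ S₁ n v' S'} (h : P.next l v S = (some l', v₁, S₁))
      (hr : Reach P l' v₁ S₁ n v' S') : Reach P l v S (n + 1) v' S'

/-- The flowchart, started at its entry, is left after exactly `n` steps. -/
def Runs (P : Flow Γ σ) (v : σ) (S : Stk Γ) (n : ℕ) (v' : σ) (S' : Stk Γ) : Prop :=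
  P.Reach P.entry v S n v' S'

/-- Determinism. It later shows that what an oracle machine does before a query cannot depend on the
answer. -/
theorem Reach.unique {P : Flow Γ σ} {l : P.Λ} {v S n v₁ S₁ m v₂ S₂} (h₁ : P.Reach l v S n v₁ S₁)
    (h₂ : P.Reach l v S m v₂ S₂) : v₁ = v₂ ∧ S₁ = S₂ := by
  induction h₁ generalizing m with
  | exit h =>
    cases h₂ with
    | exit h' => simp_all
    | step h' => simp_all
  | step h _ ih =>
    cases h₂ with
    | exit h' => simp_all
    | step h' hr =>
      rw [h] at h'
      simp only [Prod.mk.injEq, Option.some.injEq] at h'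
      obtain ⟨rfl, rfl, rfl⟩ := h'
      exact ih hr

/-- With finitely many labels, the number of pushes per step is bounded. This turns time bounds into
bounds on output lengths and on the garbage to be cleared. -/
theorem exists_growth (P : Flow Γ σ) : ∃ C : ℕ, ∀ l v S n v' S', P.Reach l v S n v' S' →
    ∀ k, (S' k).length ≤ (S k).length + C * n := by
  refine ⟨Finset.univ.sup fun l => pushes (P.code l), fun l v S n v' S' h k => ?_⟩
  have key : ∀ l v S, ((P.next l v S).2.2 k).length ≤
      (S k).length + Finset.univ.sup fun l => pushes (P.code l) := fun l v S =>
    (length_stepAux_le _ _ _ _).trans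
      (Nat.add_le_add_left (Finset.le_sup (f := fun l => pushes (P.code l)) (Finset.mem_univ l)) _)
  induction h with
  | @exit l v S _ _ h =>
    have := key l v S
    rw [h] at this
    simpa using this
  | @step l v S _ _ _ _ _ _ h _ ih =>
    have := key l v S
    rw [h] at this
    simp only at this
    rw [Nat.mul_succ]
    omega

/-! #### Lifting to more stacks and a larger state -/

/-- Let a flowchart act on some of the stacks and a component of the state. -/
def lift {K' : Type} {τ : Type} (e : K' → K) (π : Part σ τ) (P : Flow (fun k => Γ (e k)) τ) :
    Flow Γ σ where
  Λ := P.Λ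
  entry := P.entry
  code l := liftStmt e π (P.code l)

theorem Reach.lift {K' : Type} [DecidableEq K'] {τ : Type} {e : K' → K} (he : e.Injective)
    {π : Part σ τ} {P : Flow (fun k => Γ (e k)) τ} {l w T n w' T'}
    (h : P.Reach l w T n w' T') (v : σ) (S : Stk Γ) (hv : π.get v = w) (hS : ∀ k, S (e k) = T k) :
    ∃ S', (Flow.lift e π P).Reach l v S n (π.set w' v) S' ∧ (∀ k, S' (e k) = T' k) ∧
      ∀ k, (∀ k', e k' ≠ k) → S' k = S k := by
  induction h generalizing v S with
  | @exit l w T w' T' h =>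
    subst hv
    obtain ⟨h1, h2, h3, h4⟩ := stepAux_liftStmt he π (P.code l) v S T hS
    simp only [next, Prod.mk.injEq] at h
    refine ⟨(TM2.stepAux (liftStmt e π (P.code l)) v S).stk, Reach.exit ?_, ?_, h4⟩
    · simp only [next, Flow.lift, h1, h2, h]
    · simpa [h] using h3
  | @step l w T l' w₁ T₁ n w' T' h _ ih =>
    subst hv
    obtain ⟨h1, h2, h3, h4⟩ := stepAux_liftStmt he π (P.code l) v S T hS
    simp only [next, Prod.mk.injEq] at h
    obtain ⟨S', hr, ha, hb⟩ := ih (π.set w₁ v) (TM2.stepAux (liftStmt e π (P.code l)) v S).stk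
      (π.get_set _ _) (by simpa [h] using h3)
    rw [π.set_set] at hr
    refine ⟨S', Reach.step ?_ hr, ha, fun k hk => (hb k hk).trans (h4 k hk)⟩
    simp only [next, Flow.lift, h1, h2, h]

theorem Runs.lift {K' : Type} [DecidableEq K'] {τ : Type} {e : K' → K} (he : e.Injective)
    {π : Part σ τ} {P : Flow (fun k => Γ (e k)) τ} {w T n w' T'}
    (h : P.Runs w T n w' T') (v : σ) (S : Stk Γ) (hv : π.get v = w) (hS : ∀ k, S (e k) = T k) :
    ∃ S', (Flow.lift e π P).Runs v S n (π.set w' v) S' ∧ (∀ k, S' (e k) = T' k) ∧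
      ∀ k, (∀ k', e k' ≠ k) → S' k = S k :=
  Reach.lift he h v S hv hS

/-! #### Sequencing -/

/-- Run `P`, then `Q`. -/
def seq (P Q : Flow Γ σ) : Flow Γ σ where
  Λ := P.Λ ⊕ Q.Λ
  entry := .inl P.entry
  code l := match l with
    | .inl l => mapLabel (fun o => some (o.elim (.inr Q.entry) .inl)) (P.code l)
    | .inr l => mapLabel (fun o => o.map .inr) (Q.code l)

/-- The step that leaves `P` already lands on the entry of `Q`, so the times add up exactly. -/
theorem Runs.seq {P Q : Flow Γ σ} {v S n v₁ S₁ m v₂ S₂} (hP : P.Runs v S n v₁ S₁)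
    (hQ : Q.Runs v₁ S₁ m v₂ S₂) : (P.seq Q).Runs v S (n + m) v₂ S₂ := by
  have right : ∀ {l v S n v' S'}, Q.Reach l v S n v' S' →
      (P.seq Q).Reach (.inr l) v S n v' S' := by
    intro l v S n v' S' h
    induction h with
    | exit h =>
      refine .exit ?_
      simp only [next, Prod.mk.injEq] at h
      simp [next, Flow.seq, stepAux_mapLabel, h]
    | step h _ ih =>
      refine .step ?_ ih
      simp only [next, Prod.mk.injEq] at h
      simp [next, Flow.seq, stepAux_mapLabel, h]
  suffices left : ∀ {l v S n v₁ S₁}, P.Reach l v S n v₁ S₁ → Q.Runs v₁ S₁ m v₂ S₂ →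
      (P.seq Q).Reach (.inl l) v S (n + m) v₂ S₂ from left hP hQ
  intro l v S n v₁ S₁ h hQ
  induction h with
  | exit h =>
    rw [Nat.add_comm]
    refine .step ?_ (right hQ)
    simp only [next, Prod.mk.injEq] at h
    simp [next, Flow.seq, stepAux_mapLabel, h]
  | step h _ ih =>
    rw [Nat.add_right_comm]
    refine .step ?_ (ih hQ)
    simp only [next, Prod.mk.injEq] at h
    simp [next, Flow.seq, stepAux_mapLabel, h]

/-! #### Loops -/

/-- Execute `t`; leave if it jumps to `false`, otherwise run `B` and start again. -/
def loop (t : TM2.Stmt Γ Bool σ) (B : Flow Γ σ) : Flow Γ σ where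
  Λ := Option B.Λ
  entry := none
  code l := match l with
    | none => ofStmt (fun b => bif b then some (some B.entry) else none) t
    | some l => mapLabel (fun o => some o) (B.code l)

theorem Runs.loop_exit {t : TM2.Stmt Γ Bool σ} {B : Flow Γ σ} {v S v' S'}
    (h : TM2.stepAux t v S = ⟨some false, v', S'⟩) : (loop t B).Runs v S 1 v' S' := by
  refine .exit ?_
  simp [next, Flow.loop, stepAux_ofStmt, h]

theorem Runs.loop_step {t : TM2.Stmt Γ Bool σ} {B : Flow Γ σ} {v S v₁ S₁ n v₂ S₂ m v' S'}
    (h : TM2.stepAux t v S = ⟨some true, v₁, S₁⟩) (hB : B.Runs v₁ S₁ n v₂ S₂)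
    (hl : (loop t B).Runs v₂ S₂ m v' S') : (loop t B).Runs v S (n + m + 1) v' S' := by
  refine .step (l' := some B.entry) (v₁ := v₁) (S₁ := S₁) ?_ ?_
  · simp [next, Flow.loop, stepAux_ofStmt, h]
  clear h
  suffices ∀ {l v S n v₁ S₁}, B.Reach l v S n v₁ S₁ → (loop t B).Runs v₁ S₁ m v' S' →
      (loop t B).Reach (some l) v S (n + m) v' S' from this hB hl
  intro l v S n v₁ S₁ h hl
  induction h with
  | exit h =>
    rw [Nat.add_comm]
    refine .step ?_ hl
    simp only [next, Prod.mk.injEq] at h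
    simp [next, Flow.loop, stepAux_mapLabel, h]
  | step h _ ih =>
    rw [Nat.add_right_comm]
    refine .step ?_ (ih hl)
    simp only [next, Prod.mk.injEq] at h
    simp [next, Flow.loop, stepAux_mapLabel, h]

/-- Execute `t` until it jumps to `false`. -/
def again (t : TM2.Stmt Γ Bool σ) : Flow Γ σ where
  Λ := Unit
  entry := ()
  code _ := ofStmt (fun b => bif b then some () else none) t

theorem Runs.again_exit {t : TM2.Stmt Γ Bool σ} {v S v' S'}
    (h : TM2.stepAux t v S = ⟨some false, v', S'⟩) : (again t).Runs v S 1 v' S' := by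
  refine .exit ?_
  simp [next, Flow.again, stepAux_ofStmt, h]

theorem Runs.again_step {t : TM2.Stmt Γ Bool σ} {v S v₁ S₁ m v' S'}
    (h : TM2.stepAux t v S = ⟨some true, v₁, S₁⟩) (hl : (again t).Runs v₁ S₁ m v' S') :
    (again t).Runs v S (m + 1) v' S' := by
  refine Reach.step (P := again t) (l' := ()) (v₁ := v₁) (S₁ := S₁) ?_ hl
  simp [next, Flow.again, stepAux_ofStmt, h]

end Reach

end Flow

/-! ### Scanning a stack -/

section Push

variable {K : Type} {Γ : K → Type} {σ Λ : Type}

open scoped Classical in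
/-- Push the entries of the word `g v` with indices `i, …, i + n - 1`, in this order. -/
noncomputable def pushFrom (k : K) (g : σ → List (Γ k)) (q : TM2.Stmt Γ Λ σ) :
    ℕ → ℕ → TM2.Stmt Γ Λ σ
  | 0, _ => q
  | n + 1, i =>
    if h : Nonempty (Γ k) then
      .branch (fun v => decide (i < (g v).length))
        (.push k (fun v => (g v).getD i h.some) (pushFrom k g q n (i + 1))) q
    else q

/-- A statement is a fixed finite tree while the word depends on the state, so the pushes are
unrolled into nested branches. The default `h.some` is never pushed, as the branch tests `i < (g
v).length`. -/
theorem stepAux_pushFrom [DecidableEq K] (k : K) (g : σ → List (Γ k)) (q : TM2.Stmt Γ Λ σ)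
    (n i : ℕ) (v : σ) (S : Stk Γ) (h : (g v).length ≤ i + n) :
    TM2.stepAux (pushFrom k g q n i) v S =
      TM2.stepAux q v (Function.update S k (((g v).drop i).reverse ++ S k)) := by
  induction n generalizing i S with
  | zero =>
    have : (g v).drop i = [] := List.drop_eq_nil_of_le h
    simp [pushFrom, this]
  | succ n ih =>
    rw [pushFrom]
    split_ifs with hne
    · by_cases hi : i < (g v).length
      · simp only [TM2.stepAux, hi, decide_true, cond_true]
        rw [ih (i + 1) _ (by omega), List.drop_eq_getElem_cons hi]
        simp only [List.getD_eq_getElem _ _ hi, Function.update_self, Function.update_idem,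
          List.reverse_cons, List.append_assoc, List.cons_append, List.nil_append]
      · simp [TM2.stepAux, hi, List.drop_eq_nil_of_le (not_lt.mp hi)]
    · have : g v = [] := by
        cases hg : g v with
        | nil => rfl
        | cons a l => exact absurd ⟨a⟩ hne
      simp [this]

/-- Push the words `g v k` onto the stacks `k` in `ks`. -/
noncomputable def pushAll (g : σ → Stk Γ) (N : ℕ) (q : TM2.Stmt Γ Λ σ) :
    List K → TM2.Stmt Γ Λ σ
  | [] => q
  | k :: ks => pushFrom k (fun v => g v k) (pushAll g N q ks) N 0

theorem stepAux_pushAll [DecidableEq K] (g : σ → Stk Γ) (N : ℕ) (q : TM2.Stmt Γ Λ σ) (ks : List K)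
    (hks : ks.Nodup) (v : σ) (S : Stk Γ) (h : ∀ k, (g v k).length ≤ N) :
    TM2.stepAux (pushAll g N q ks) v S =
      TM2.stepAux q v fun k => if k ∈ ks then (g v k).reverse ++ S k else S k := by
  induction ks generalizing S with
  | nil => simp [pushAll]
  | cons k ks ih =>
    rw [pushAll, stepAux_pushFrom _ _ _ _ _ _ _ (by simpa using h k),
      ih (List.nodup_cons.mp hks).2]
    congr 1
    funext k'
    by_cases h' : k' = k
    · subst h'
      simp [(List.nodup_cons.mp hks).1]
    · simp [h']

end Push

namespace Flow

section Scan

variable {K : Type} [DecidableEq K] [Fintype K] {Γ : K → Type} {σ : Type} [Fintype σ]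

/-- Pop the symbols of stack `k` one after the other. Each symbol, and finally the end of the stack,
updates the state by `rd`; then the words `emit v` are pushed. -/
noncomputable def scan (k : K) (rd : Option (Γ k) → σ → σ) (emit : σ → Stk Γ) (more : σ → Bool) :
    Flow Γ σ :=
  again (.pop k (fun v o => rd o v)
    (pushAll emit (Finset.univ.sup fun v => Finset.univ.sup fun k => (emit v k).length)
      (.goto more) Finset.univ.toList))

/-- The words pushed while scanning. -/
def scanOut {A σ : Type} {Γ : K → Type} (rd : Option A → σ → σ) (emit : σ → Stk Γ) :
    σ → List A → Stk Γ
  | v, [], k => emit (rd none v) k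
  | v, a :: l, k => emit (rd (some a) v) k ++ scanOut rd emit (rd (some a) v) l k

/-- By `hk` the scanned stack only shrinks; the extra step is the pop that finds it empty. -/
theorem runs_scan {k : K} {rd : Option (Γ k) → σ → σ} {emit : σ → Stk Γ} {more : σ → Bool}
    (h₁ : ∀ a v, more (rd (some a) v) = true) (h₀ : ∀ v, more (rd none v) = false)
    (hk : ∀ v, emit v k = []) (v : σ) (S : Stk Γ) :
    (scan k rd emit more).Runs v S ((S k).length + 1)
      (rd none ((S k).foldl (fun v a => rd (some a) v) v))
      (fun k' => (scanOut rd emit v (S k) k').reverse ++ Function.update S k [] k') := by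
  have key : ∀ (o : Option (Γ k)) (v : σ) (S : Stk Γ), o = (S k).head? →
      TM2.stepAux (.pop k (fun v o => rd o v)
        (pushAll emit (Finset.univ.sup fun v => Finset.univ.sup fun k => (emit v k).length)
          (.goto more) Finset.univ.toList)) v S =
      ⟨some (more (rd o v)), rd o v,
        fun k' => (emit (rd o v) k').reverse ++ Function.update S k (S k).tail k'⟩ := by
    intro o v S ho
    rw [TM2.stepAux, stepAux_pushAll]
    · simp [TM2.stepAux, ho]
    · exact Finset.nodup_toList _
    · intro k'
      exact (Finset.le_sup (f := fun k' => (emit (rd (S k).head? v) k').length)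
        (Finset.mem_univ k')).trans (Finset.le_sup
          (f := fun v => Finset.univ.sup fun k' => (emit v k').length) (Finset.mem_univ _))
  generalize hl : S k = l
  induction l generalizing v S with
  | nil =>
    refine Runs.again_exit ?_
    rw [key none v S (by simp [hl]), h₀]
    simp [scanOut, hl]
  | cons a l ih =>
    refine Runs.again_step (v₁ := rd (some a) v)
      (S₁ := fun k' => (emit (rd (some a) v) k').reverse ++ Function.update S k (S k).tail k') ?_ ?_
    · rw [key (some a) v S (by simp [hl]), h₁]
    · have h := ih (rd (some a) v)
        (fun k' => (emit (rd (some a) v) k').reverse ++ Function.update S k (S k).tail k')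
        (by simp [hk, hl])
      have e : (fun k' => (scanOut rd emit v (a :: l) k').reverse ++ Function.update S k [] k') =
          fun k' => (scanOut rd emit (rd (some a) v) l k').reverse ++
            Function.update (fun k' => (emit (rd (some a) v) k').reverse ++
              Function.update S k (S k).tail k') k [] k' := by
        funext k'
        by_cases h' : k' = k
        · subst h'; simp [scanOut, hk]
        · simp [scanOut, h']
      rw [e]
      exact h

/-- Empty the stack `k`, pushing the words `emit (ρ a)` for its symbols `a`. The second component
of the state serves as a register. -/
noncomputable def drain {τ R : Type} [Fintype τ] [Fintype R] (k : K) (ρ : Γ k → R)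
    (emit : R → Stk Γ) : Flow Γ (τ × Option R) :=
  scan k (fun o v => (v.1, o.map ρ)) (fun v k' => v.2.elim [] fun r => emit r k')
    (fun v => v.2.isSome)

/-- Draining reverses the word, which is why order-preserving transfers below use two drains. -/
theorem runs_drain {τ R : Type} [Fintype τ] [Fintype R] {k : K} {ρ : Γ k → R} {emit : R → Stk Γ}
    (hk : ∀ r, emit r k = []) (v : τ) (r : Option R) (S : Stk Γ) :
    (drain k ρ emit).Runs (v, r) S ((S k).length + 1) (v, none)
      (fun k' => ((S k).flatMap fun a => emit (ρ a) k').reverse ++ Function.update S k [] k') := by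
  have h := runs_scan (k := k) (rd := fun o (v : τ × Option R) => (v.1, o.map ρ))
    (emit := fun v k' => v.2.elim [] fun r => emit r k') (more := fun v => v.2.isSome)
    (by simp) (by simp) (by rintro ⟨v, _ | r⟩ <;> simp [hk]) (v, r) S
  have e₁ : ∀ (l : List (Γ k)) (r : Option R),
      (l.foldl (fun (v : τ × Option R) a => (v.1, (some a).map ρ)) (v, r)).1 = v := by
    intro l
    induction l with
    | nil => simp
    | cons a l ih => intro r; simpa using ih _
  have e₂ : ∀ (k' : K) (l : List (Γ k)) (r : Option R),
      scanOut (fun o (v : τ × Option R) => (v.1, o.map ρ))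
        (fun v k' => v.2.elim [] fun r => emit r k') (v, r) l k' =
      l.flatMap fun a => emit (ρ a) k' := by
    intro k' l
    induction l with
    | nil => simp [scanOut]
    | cons a l ih => intro r; simp [scanOut, ih (some (ρ a))]
  rw [e₁] at h
  simp only [e₂] at h
  exact h

end Scan

end Flow

/-! ### Flowcharts and Turing machines -/

section Machines

/-- A Turing machine as a flowchart started at the label `l₀`. The labels satisfying `exits` lead to
the exit. -/
noncomputable def Flow.ofTM (tm : FinTM2) (l₀ : tm.Λ) (exits : tm.Λ → Prop) : Flow tm.Γ tm.σ :=
  open scoped Classical in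
  { Λ := tm.Λ
    fin := tm.ΛFin
    entry := l₀
    code := fun l => if exits l then .goto fun _ => none else ofStmt some (tm.m l) }

/-- The statements of the Turing machine given by a flowchart. -/
def Flow.stmts {K : Type} {Γ : K → Type} {σ : Type} (P : Flow Γ σ) (l : P.Λ) :
    TM2.Stmt Γ P.Λ σ :=
  toStmt id P.entry (P.code l)

/-- A flowchart as a Turing machine. -/
def Flow.toTM {K : Type} [DecidableEq K] [Fintype K] {Γ : K → Type} {σ : Type} [Fintype σ]
    (P : Flow Γ σ) (k₀ k₁ : K) [Fintype (Γ k₀)] (v₀ : σ) : FinTM2 where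
  K := K
  k₀ := k₀
  k₁ := k₁
  Γ := Γ
  Λ := P.Λ
  main := P.entry
  σ := σ
  initialState := v₀
  m := P.stmts

/-- All stacks empty but one. -/
def single {K : Type} [DecidableEq K] {Γ : K → Type} (k : K) (l : List (Γ k)) : Stk Γ :=
  Function.update (fun _ => []) k l

theorem initList_stk (tm : FinTM2) (s : List (tm.Γ tm.k₀)) :
    (initList tm s).stk = single tm.k₀ s := by
  funext k
  by_cases h : k = tm.k₀
  · subst h; simp [initList, single]
  · simp [initList, single, h]

theorem haltList_stk (tm : FinTM2) (s : List (tm.Γ tm.k₁)) :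
    (haltList tm s).stk = single tm.k₁ s := by
  funext k
  by_cases h : k = tm.k₁
  · subst h; simp [haltList, single]
  · simp [haltList, single, h]

theorem iterate_bind_none {α : Type} (f : α → Option α) (n : ℕ) :
    (flip bind f)^[n] none = none := by
  induction n with
  | zero => rfl
  | succ n ih => rw [Function.iterate_succ_apply]; exact ih

theorem iterate_bind_succ {α : Type} (f : α → Option α) (n : ℕ) (a : α) :
    (flip bind f)^[n + 1] (some a) = (flip bind f)^[n] (f a) := by
  rw [Function.iterate_succ_apply]; rfl

theorem Flow.reach_ofTM {tm : FinTM2} {l₀ l : tm.Λ} {n : ℕ} {v S} {c : tm.Cfg}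
    (h : (flip bind (TM2.step tm.m))^[n] (some ⟨some l, v, S⟩) = some c) (hc : c.l = none) :
    (Flow.ofTM tm l₀ fun _ => False).Reach l v S n c.var c.stk := by
  induction n generalizing l v S with
  | zero =>
    cases h
    cases hc
  | succ n ih =>
    rw [iterate_bind_succ, TM2.step] at h
    have hnext : (Flow.ofTM tm l₀ fun _ => False).next l v S =
        ((TM2.stepAux (tm.m l) v S).l, (TM2.stepAux (tm.m l) v S).var,
          (TM2.stepAux (tm.m l) v S).stk) := by
      simp only [Flow.next, Flow.ofTM, if_false, stepAux_ofStmt]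
      cases (TM2.stepAux (tm.m l) v S).l <;> rfl
    revert h hnext
    generalize TM2.stepAux (tm.m l) v S = c₁
    intro h hnext
    obtain ⟨l₁, v₁, S₁⟩ := c₁
    cases l₁ with
    | none =>
      cases n with
      | zero =>
        cases h
        exact .exit hnext
      | succ n =>
        rw [iterate_bind_succ, TM2.step, iterate_bind_none] at h
        cases h
    | some l₁ => exact .step hnext (ih h)

theorem Flow.Reach.iterate_step {K : Type} [DecidableEq K] {Γ : K → Type} {σ : Type}
    {P : Flow Γ σ} {l v S n v' S'} (h : P.Reach l v S n v' S') :
    (flip bind (TM2.step P.stmts))^[n] (some ⟨some l, v, S⟩) = some ⟨none, v', S'⟩ := by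
  have hstep : ∀ l v S, TM2.step P.stmts ⟨some l, v, S⟩ =
      some ⟨(P.next l v S).1, (P.next l v S).2.1, (P.next l v S).2.2⟩ := by
    intro l v S
    exact congrArg some (stepAux_toStmt id P.entry (P.code l) v S)
  induction h with
  | exit h => rw [iterate_bind_succ, hstep, h]; rfl
  | step h _ ih => rw [iterate_bind_succ, hstep, h]; exact ih

end Machines

end QueryOrder

/-! ### Clean-up, subroutines and composition of polynomial-time functions -/

namespace QueryOrder

open Turing

theorem eval_mono (p : Polynomial ℕ) {m n : ℕ} (h : m ≤ n) : p.eval m ≤ p.eval n := by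
  rw [Polynomial.eval_eq_sum, Polynomial.eval_eq_sum]
  exact Finset.sum_le_sum fun i _ => Nat.mul_le_mul_left _ (Nat.pow_le_pow_left h i)

section Single

variable {K : Type} [DecidableEq K] {Γ : K → Type}

@[simp] theorem single_self (k : K) (l : List (Γ k)) : single k l k = l := by simp [single]

@[simp] theorem single_of_ne {k k' : K} (h : k' ≠ k) (l : List (Γ k)) : single k l k' = [] := by
  simp [single, h]

theorem single_apply_of_injective {K' : Type} [DecidableEq K'] {e : K' → K} (he : e.Injective)
    (k k' : K') (l : List (Γ (e k))) :
    single (e k) l (e k') = single (Γ := fun k => Γ (e k)) k l k' := by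
  by_cases h : k' = k
  · subst h; simp
  · rw [single_of_ne h, single_of_ne (fun h' => h (he h'))]

theorem length_single_le (k k' : K) (l : List (Γ k)) : (single k l k').length ≤ l.length := by
  by_cases h : k' = k
  · subst h; simp
  · simp [h]

end Single

/-- The first component of a state. -/
def Part.fst (τ R : Type) : Part (τ × R) τ where
  get := Prod.fst
  set a v := (a, v.2)
  get_set _ _ := rfl
  set_get _ := rfl
  set_set _ _ _ := rfl

/-- The second component of a state. -/
def Part.snd (τ R : Type) : Part (R × τ) τ where
  get := Prod.snd
  set a v := (v.1, a)
  get_set _ _ := rfl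
  set_get _ := rfl
  set_set _ _ _ := rfl

/-- A component of a component. -/
def Part.comp {σ τ ρ : Type} (π : Part σ τ) (π' : Part τ ρ) : Part σ ρ where
  get v := π'.get (π.get v)
  set a v := π.set (π'.set a (π.get v)) v
  get_set a v := by rw [π.get_set, π'.get_set]
  set_get v := by rw [π'.set_get, π.set_get]
  set_set a b v := by rw [π.get_set, π'.set_set, π.set_set]

namespace Flow

variable {K : Type} [DecidableEq K] [Fintype K] {Γ : K → Type} {τ : Type} [Fintype τ]

/-- Run `P`, then empty the stacks in `ks`. -/
noncomputable def thenClear (P : Flow Γ (τ × Option Unit)) (ks : List K) :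
    Flow Γ (τ × Option Unit) :=
  ks.foldl (fun P k => P.seq (drain k (fun _ => ()) fun _ _ => [])) P

/-- Clearing lengthens no stack, so the same bound `B` serves for every drain. -/
theorem Runs.thenClear {P : Flow Γ (τ × Option Unit)} {v S n v' r S'}
    (h : P.Runs v S n (v', r) S') (ks : List K) {B : ℕ} (hB : ∀ k, (S' k).length ≤ B) :
    ∃ m r', m ≤ n + ks.length * (B + 1) ∧
      (P.thenClear ks).Runs v S m (v', r') (fun k => if k ∈ ks then [] else S' k) := by
  induction ks generalizing P n r S' with
  | nil => exact ⟨n, r, by simp, by simpa [Flow.thenClear] using h⟩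
  | cons k ks ih =>
    have h' := h.seq (runs_drain (k := k) (ρ := fun _ => ()) (emit := fun _ _ => []) (by simp)
      v' r S')
    obtain ⟨m, r', hm, hr⟩ := ih h' (fun k' => by
      by_cases hk : k' = k
      · subst hk; simp
      · simpa [hk] using hB k')
    refine ⟨m, r', ?_, ?_⟩
    · have := hB k
      simp only [List.length_cons]
      nlinarith
    · have e : (fun k' => if k' ∈ k :: ks then [] else S' k') = fun k' => if k' ∈ ks then [] else
          ((S' k).flatMap fun _ => ([] : List (Γ k'))).reverse ++ Function.update S' k [] k' := by
        funext k'
        by_cases hk : k' = k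
        · subst hk; simp
        · rw [Function.update_of_ne hk, List.flatMap_eq_nil_iff.mpr fun _ _ => rfl]
          simp [hk]
      rw [e]
      exact hr

end Flow

/-- A function computed in polynomial time by a flowchart, leaving garbage on the stacks other than
the output stack, is computable in polynomial time. -/
theorem polyTime_of_flow {K : Type} [DecidableEq K] [Fintype K] {Γ : K → Type} {σ : Type}
    [Fintype σ] {α β αΓ βΓ : Type} {ea : α → List αΓ} {eb : β → List βΓ} {f : α → β}
    (P : Flow Γ σ) (k₀ k₁ : K) [Fintype (Γ k₀)] (i₀ : Γ k₀ ≃ αΓ) (i₁ : Γ k₁ ≃ βΓ) (v₀ : σ)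
    (p : Polynomial ℕ)
    (h : ∀ a, ∃ n v' S', n ≤ p.eval (ea a).length ∧
      P.Runs v₀ (single k₀ ((ea a).map i₀.symm)) n v' S' ∧ S' k₁ = (eb (f a)).map i₁.symm) :
    PolyTime ea eb f := by
  classical
  obtain ⟨C, hC⟩ := P.exists_growth
  set ks : List K := (Finset.univ.erase k₁).toList with hks
  -- `haltList` demands the initial internal state and nothing but the output on the stacks, so `Q`
  -- clears all stacks except `k₁` and then reloads the state.
  let P₁ : Flow Γ (σ × Option Unit) := Flow.lift (fun k => k) (Part.fst _ _) P
  let Q : Flow Γ (σ × Option Unit) := (P₁.thenClear ks).seq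
    (Flow.again (.load (fun _ => (v₀, none)) (.goto fun _ => false)))
  refine ⟨{
    tm := Q.toTM k₀ k₁ (v₀, none)
    inputAlphabet := i₀
    outputAlphabet := i₁
    time := p + Polynomial.C ks.length * (Polynomial.X + Polynomial.C C * p + 1) + 1
    outputsFun := fun a => Classical.choice ?_ }⟩
  obtain ⟨n, v', S', hn, hr, hout⟩ := h a
  obtain ⟨S₁, hr₁, hS₁, -⟩ := Flow.Runs.lift (π := Part.fst σ (Option Unit)) (e := fun k : K => k)
    (fun _ _ h => h) hr (v₀, none) _ rfl (fun _ => rfl)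
  obtain rfl : S₁ = S' := funext hS₁
  obtain ⟨m, r, hm, hr₂⟩ := Flow.Runs.thenClear hr₁ ks (B := (ea a).length + C * n) (fun k => by
    refine (hC _ _ _ _ _ _ hr k).trans (Nat.add_le_add_right ?_ _)
    simpa using length_single_le k₀ k ((ea a).map i₀.symm))
  have hr₃ := hr₂.seq (Q := Flow.again (.load (fun _ => (v₀, none)) (.goto fun _ => false)))
    (Flow.Runs.again_exit (by simp only [TM2.stepAux]; rfl))
  have hfin : (fun k => if k ∈ ks then [] else S₁ k) = single k₁ ((eb (f a)).map i₁.symm) := by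
    funext k
    by_cases hk : k = k₁
    · subst hk; simp [hks, hout]
    · simp [hks, hk]
  rw [hfin] at hr₃
  have hit := Flow.Reach.iterate_step hr₃
  refine ⟨⟨⟨m + 1, ?_⟩, ?_⟩⟩
  · have e₀ : initList (Q.toTM k₀ k₁ (v₀, none)) ((ea a).map i₀.invFun) =
        (⟨some Q.entry, (v₀, none), single k₀ ((ea a).map i₀.symm)⟩ : TM2.Cfg Γ Q.Λ _) := by
      have := initList_stk (Q.toTM k₀ k₁ (v₀, none)) ((ea a).map i₀.invFun)
      change TM2.Cfg.mk _ _ (initList (Q.toTM k₀ k₁ (v₀, none)) ((ea a).map i₀.invFun)).stk = _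
      rw [this]; rfl
    have e₁ : haltList (Q.toTM k₀ k₁ (v₀, none)) ((eb (f a)).map i₁.invFun) =
        (⟨none, (v₀, none), single k₁ ((eb (f a)).map i₁.symm)⟩ : TM2.Cfg Γ Q.Λ _) := by
      have := haltList_stk (Q.toTM k₀ k₁ (v₀, none)) ((eb (f a)).map i₁.invFun)
      change TM2.Cfg.mk _ _ (haltList (Q.toTM k₀ k₁ (v₀, none)) ((eb (f a)).map i₁.invFun)).stk = _
      rw [this]; rfl
    rw [e₀]
    simp only [Option.map_some]
    rw [e₁]
    exact hit
  · simp only [Polynomial.eval_add, Polynomial.eval_mul, Polynomial.eval_C, Polynomial.eval_X,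
      Polynomial.eval_one]
    have : ks.length * ((ea a).length + C * n + 1) ≤
        ks.length * ((ea a).length + C * p.eval (ea a).length + 1) := by gcongr
    omega

theorem PolyTime.exists_flow {α β αΓ βΓ : Type} {ea : α → List αΓ} {eb : β → List βΓ} {f : α → β}
    (h : PolyTime ea eb f) :
    ∃ (tm : FinTM2) (i₀ : tm.Γ tm.k₀ ≃ αΓ) (i₁ : tm.Γ tm.k₁ ≃ βΓ) (p : Polynomial ℕ),
      ∀ a, ∃ n, n ≤ p.eval (ea a).length ∧
        (Flow.ofTM tm tm.main fun _ => False).Runs tm.initialState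
          (single tm.k₀ ((ea a).map i₀.symm)) n tm.initialState
          (single tm.k₁ ((eb (f a)).map i₁.symm)) := by
  obtain ⟨M⟩ := h
  refine ⟨M.tm, M.inputAlphabet, M.outputAlphabet, M.time, fun a => ?_⟩
  obtain ⟨⟨n, hn⟩, hle⟩ := M.outputsFun a
  refine ⟨n, hle, ?_⟩
  have := Flow.reach_ofTM (l₀ := M.tm.main) (l := M.tm.main) (v := M.tm.initialState)
    (S := (initList M.tm ((ea a).map M.inputAlphabet.invFun)).stk)
    (c := haltList M.tm ((eb (f a)).map M.outputAlphabet.invFun)) (hn : _) rfl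
  rw [initList_stk, haltList_stk] at this
  exact this

theorem PolyTime.length_le {α β αΓ βΓ : Type} {ea : α → List αΓ} {eb : β → List βΓ} {f : α → β}
    (h : PolyTime ea eb f) :
    ∃ p : Polynomial ℕ, ∀ a, (eb (f a)).length ≤ p.eval (ea a).length := by
  obtain ⟨tm, i₀, i₁, p, h⟩ := h.exists_flow
  obtain ⟨C, hC⟩ := (Flow.ofTM tm tm.main fun _ => False).exists_growth
  refine ⟨Polynomial.X + Polynomial.C C * p, fun a => ?_⟩
  obtain ⟨n, hn, hr⟩ := h a
  have h₁ := hC _ _ _ _ _ _ hr tm.k₁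
  have h₂ := length_single_le tm.k₀ tm.k₁ ((ea a).map i₀.symm)
  simp only [single_self, List.length_map] at h₁ h₂
  simp only [Polynomial.eval_add, Polynomial.eval_mul, Polynomial.eval_C, Polynomial.eval_X]
  have : C * n ≤ C * p.eval (ea a).length := by gcongr
  omega

/-- Change the encodings, and reindex the domain. -/
theorem PolyTime.congr {α α' β β' αΓ βΓ : Type} {ea : α → List αΓ} {eb : β → List βΓ} {f : α → β}
    (h : PolyTime ea eb f) {ea' : α' → List αΓ} {eb' : β' → List βΓ} {f' : α' → β'} (g : α' → α)
    (h₁ : ∀ a, ea' a = ea (g a)) (h₂ : ∀ a, eb' (f' a) = eb (f (g a))) : PolyTime ea' eb' f' := by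
  obtain ⟨M⟩ := h
  exact ⟨{ M with outputsFun := fun a => by rw [h₁, h₂]; exact M.outputsFun (g a) }⟩

/-- String-valued functions computable in polynomial time. -/
abbrev PT {α A B : Type} (ea : α → List A) (F : α → List B) : Prop := PolyTime ea id F

theorem polyTime_iff_PT {α β A B : Type} {ea : α → List A} {eb : β → List B} {f : α → β} :
    PolyTime ea eb f ↔ PT ea fun a => eb (f a) :=
  ⟨fun h => h.congr id (fun _ => rfl) fun _ => rfl, fun h => h.congr id (fun _ => rfl) fun _ => rfl⟩

theorem fintype_of_PT {α A B : Type} {ea : α → List A} {F : α → List B} (h : PT ea F) :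
    Nonempty (Fintype A) := by
  obtain ⟨M⟩ := h
  exact ⟨@Fintype.ofEquiv _ _ M.tm.Γk₀Fin M.inputAlphabet⟩

/-- Run a Turing machine as a subroutine. -/
theorem Flow.Runs.subroutine {K K' : Type} [DecidableEq K] [DecidableEq K'] {Γ : K → Type}
    {σ τ : Type} {e : K' → K} (he : e.Injective) (π : Part σ τ)
    {P : Flow (fun k => Γ (e k)) τ} {k₀ k₁ : K'} {x : List (Γ (e k₀))} {y : List (Γ (e k₁))} {n w}
    (hr : P.Runs w (single k₀ x) n w (single k₁ y)) {v : σ} {S : Stk Γ} (hv : π.get v = w)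
    (hx : S (e k₀) = x) (hS : ∀ k, k ≠ k₀ → S (e k) = []) :
    ∃ S', (Flow.lift e π P).Runs v S n v S' ∧ S' (e k₁) = y ∧
      ∀ k, (∀ k', e k' ≠ k) → S' k = S k := by
  obtain ⟨S', h₁, h₂, h₃⟩ := hr.lift he v S hv (fun k => by
    by_cases hk : k = k₀
    · subst hk; simp [hx]
    · simp [hk, hS])
  rw [← hv, π.set_get] at h₁
  exact ⟨S', h₁, by rw [h₂, single_self], h₃⟩

section Move

variable {K : Type} [DecidableEq K] [Fintype K] {Γ : K → Type} {τ R : Type} [Fintype τ] [Fintype R]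

/-- Move the contents of stack `k` to stack `t`. -/
theorem Flow.runs_move {k t : K} (hkt : k ≠ t) (ρ : Γ k → R) (w : R → List (Γ t)) (g : Γ k → Γ t)
    (hg : ∀ a, w (ρ a) = [g a]) (v : τ) (r : Option R) (S : Stk Γ) :
    ∃ S', (drain k ρ fun r => single t (w r)).Runs (v, r) S ((S k).length + 1) (v, none) S' ∧
      S' t = ((S k).map g).reverse ++ S t ∧ S' k = [] ∧
      ∀ k', k' ≠ k → k' ≠ t → S' k' = S k' := by
  refine ⟨_, runs_drain (fun r => by simp [hkt]) v r S, ?_, ?_, fun k' h₁ h₂ => ?_⟩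
  · simp [hkt.symm, List.map_eq_flatMap, hg]
  · simp [hkt]
  · simp [h₁, h₂]

/-- Empty the stack `k`, writing to two stacks. -/
theorem Flow.runs_split {k t₁ t₂ : K} (h₁ : k ≠ t₁) (h₂ : k ≠ t₂) (h₁₂ : t₁ ≠ t₂) (ρ : Γ k → R)
    (w₁ : R → List (Γ t₁)) (w₂ : R → List (Γ t₂)) (v : τ) (r : Option R) (S : Stk Γ) :
    ∃ S', (drain k ρ fun r k' => single t₁ (w₁ r) k' ++ single t₂ (w₂ r) k').Runs
        (v, r) S ((S k).length + 1) (v, none) S' ∧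
      S' t₁ = ((S k).flatMap fun a => w₁ (ρ a)).reverse ++ S t₁ ∧
      S' t₂ = ((S k).flatMap fun a => w₂ (ρ a)).reverse ++ S t₂ ∧ S' k = [] ∧
      ∀ k', k' ≠ k → k' ≠ t₁ → k' ≠ t₂ → S' k' = S k' := by
  refine ⟨_, runs_drain (fun r => by simp [h₁, h₂]) v r S, ?_, ?_, ?_, fun k' h h' h'' => ?_⟩
  · simp [h₁.symm, h₁₂]
  · simp [h₂.symm, h₁₂.symm]
  · simp [h₁, h₂]
  · simp [h, h', h'']

end Move

theorem reverse_map_map_symm {A B : Type} (i : A ≃ B) (l : List B) :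
    ((l.map i.symm).map fun a => i a).reverse ++ [] = l.reverse := by
  simp

theorem reverse_map_reverse_append_nil {A B : Type} (f : A → B) (l : List A) :
    (l.reverse.map fun a => f a).reverse ++ [] = l.map f := by
  simp

/-- The intermediate word passes through a spare stack `t`, being reversed twice. Its length is
bounded by `q`, whence the term `p₂.comp q` in the running time. -/
theorem PT.comp {α β A B C : Type} [Fintype B] {ea : α → List A} {eb : β → List B}
    {f : α → β} {G : β → List C} (hf : PT ea fun a => eb (f a)) (hG : PT eb G) :
    PT ea fun a => G (f a) := by
  obtain ⟨q, hq⟩ := hf.length_le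
  obtain ⟨tm₁, i₀, i₁, p₁, h₁⟩ := hf.exists_flow
  obtain ⟨tm₂, j₀, j₁, p₂, h₂⟩ := hG.exists_flow
  have := tm₁.kFin
  have := tm₂.kFin
  have := tm₁.σFin
  have := tm₂.σFin
  let K : Type := tm₁.K ⊕ tm₂.K ⊕ Unit
  let Γ : K → Type := Sum.elim tm₁.Γ (Sum.elim tm₂.Γ fun _ => B)
  let σ : Type := (tm₁.σ × tm₂.σ) × Option B
  let e₁ : tm₁.K → K := Sum.inl
  let e₂ : tm₂.K → K := fun k => Sum.inr (Sum.inl k)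
  let t : K := Sum.inr (Sum.inr ())
  let π₁ : Part σ tm₁.σ := (Part.fst _ _).comp (Part.fst _ _)
  let π₂ : Part σ tm₂.σ := (Part.fst _ _).comp (Part.snd _ _)
  have ht₁ : ∀ k, t ≠ e₁ k := nofun
  have ht₂ : ∀ k, t ≠ e₂ k := fun k h => nomatch Sum.inr_injective h
  have h₁₂ : ∀ k k', e₁ k ≠ e₂ k' := nofun
  have he₁ : e₁.Injective := Sum.inl_injective
  have he₂ : e₂.Injective := Sum.inr_injective.comp Sum.inl_injective
  let F₁ : Flow Γ σ := Flow.lift e₁ π₁ (Flow.ofTM tm₁ tm₁.main fun _ => False)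
  let D₁ : Flow Γ σ := Flow.drain (e₁ tm₁.k₁) (fun b : tm₁.Γ tm₁.k₁ => i₁ b)
    fun r => single t [r]
  let D₂ : Flow Γ σ := Flow.drain t (fun b : B => b) fun r => single (e₂ tm₂.k₀) [j₀.symm r]
  let F₂ : Flow Γ σ := Flow.lift e₂ π₂ (Flow.ofTM tm₂ tm₂.main fun _ => False)
  have : Fintype (Γ (e₁ tm₁.k₀)) := tm₁.Γk₀Fin
  refine polyTime_of_flow (Γ := Γ) (F₁.seq (D₁.seq (D₂.seq F₂))) (e₁ tm₁.k₀) (e₂ tm₂.k₁)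
    i₀ j₁ ((tm₁.initialState, tm₂.initialState), none)
    (p₁ + ((q + 1) + ((q + 1) + p₂.comp q))) fun a => ?_
  obtain ⟨n₁, hn₁, hr₁⟩ := h₁ a
  obtain ⟨n₂, hn₂, hr₂⟩ := h₂ (f a)
  obtain ⟨S₁, hr₁, hS₁, hS₁'⟩ := Flow.Runs.subroutine (Γ := Γ) he₁ π₁ hr₁
    (v := ((tm₁.initialState, tm₂.initialState), none))
    (S := single (e₁ tm₁.k₀) ((ea a).map i₀.symm)) rfl (single_self _ _)
    (fun k hk => single_of_ne (fun h => hk (he₁ h)) _)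
  obtain ⟨S₂, hr₂', hS₂t, -, hS₂⟩ := Flow.runs_move (Γ := Γ) (k := e₁ tm₁.k₁) (t := t)
    (ht₁ _).symm (fun b : tm₁.Γ tm₁.k₁ => i₁ b) (fun b => [b]) (fun b => i₁ b) (fun _ => rfl)
    (tm₁.initialState, tm₂.initialState) none S₁
  obtain ⟨S₃, hr₃, hS₃t, -, hS₃⟩ := Flow.runs_move (Γ := Γ) (k := t) (t := e₂ tm₂.k₀)
    (ht₂ _) (fun b : B => b) (fun b => [j₀.symm b]) (fun b => j₀.symm b) (fun _ => rfl)
    (tm₁.initialState, tm₂.initialState) none S₂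
  have h₀ : ∀ k, S₂ (e₂ k) = [] := fun k => by
    rw [hS₂ _ (h₁₂ _ _).symm (ht₂ _).symm, hS₁' _ fun _ => h₁₂ _ _, single_of_ne (h₁₂ _ _).symm]
  have ht : S₂ t = (eb (f a)).reverse := by
    rw [hS₂t, hS₁, hS₁' _ fun _ => (ht₁ _).symm, single_of_ne (ht₁ _)]
    exact reverse_map_map_symm i₁ _
  obtain ⟨S₄, hr₄, hS₄, -⟩ := Flow.Runs.subroutine (Γ := Γ) he₂ π₂ hr₂
    (v := ((tm₁.initialState, tm₂.initialState), none)) (S := S₃) rfl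
    (by rw [hS₃t, ht, h₀]; exact reverse_map_reverse_append_nil _ _)
    (fun k hk => by rw [hS₃ _ (ht₂ _).symm (fun h => hk (he₂ h)), h₀])
  refine ⟨_, _, _, ?_, hr₁.seq (hr₂'.seq (hr₃.seq hr₄)), hS₄⟩
  have l₁ : (S₁ (e₁ tm₁.k₁)).length = (eb (f a)).length := by rw [hS₁]; exact List.length_map _
  have l₂ : (S₂ t).length = (eb (f a)).length := by rw [ht]; exact List.length_reverse
  rw [l₁, l₂]
  have := hq a
  have := eval_mono p₂ this
  simp only [Polynomial.eval_add, Polynomial.eval_comp, Polynomial.eval_one, id] at *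
  omega

end QueryOrder

/-! ### Pairing two polynomial-time functions -/

namespace QueryOrder

open Turing

theorem flatMap_reverse_map_reverse {A B : Type} (f : A → B) (l : List A) :
    (l.reverse.flatMap fun a => [f a]).reverse ++ [] = l.map f := by
  rw [← List.map_eq_flatMap]
  simp

theorem reverse_map_append_reverse {B C D : Type} (f : B → D) (g : C → D) (l : List B)
    (l' : List C) : (((l'.map g).reverse ++ (l.map f).reverse).map fun a => a).reverse ++ [] =
      l.map f ++ l'.map g := by
  rw [List.map_id']
  simp

theorem reverse_map_self_append_nil {A : Type} (l : List A) :
    (l.map fun a => a).reverse ++ [] = l.reverse := by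
  simp

theorem length_reverse_map_append {B C D : Type} (f : B → D) (g : C → D) (l : List B)
    (l' : List C) : ((l'.map g).reverse ++ (l.map f).reverse).length = l'.length + l.length := by
  simp

theorem map_inr_map {A B C : Type} (i : A ≃ B) (j : B → C) (l : List B) :
    (l.map i.symm).map (fun a => j (i a)) = l.map j := by
  simp

/-- The input is reversed once and then split onto the input stacks of both machines. Both outputs
pile up reversed on `y false`, with `G a` on top, and a last drain restores the order. The tags let
later transducers tell the two words apart. -/
theorem PT.pair {α A B C : Type} [Fintype B] [Fintype C] {ea : α → List A} {F : α → List B}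
    {G : α → List C} (hF : PT ea F) (hG : PT ea G) :
    PT ea fun a => (F a).map (Sum.inl : B → B ⊕ C) ++ (G a).map Sum.inr := by
  obtain ⟨fA⟩ := fintype_of_PT hF
  obtain ⟨q₁, hq₁⟩ := hF.length_le
  obtain ⟨q₂, hq₂⟩ := hG.length_le
  obtain ⟨tm₁, i₀, i₁, p₁, h₁⟩ := hF.exists_flow
  obtain ⟨tm₂, j₀, j₁, p₂, h₂⟩ := hG.exists_flow
  have := tm₁.kFin
  have := tm₂.kFin
  have := tm₁.σFin
  have := tm₂.σFin
  let K : Type := tm₁.K ⊕ tm₂.K ⊕ Bool ⊕ Bool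
  let Γ : K → Type :=
    Sum.elim tm₁.Γ (Sum.elim tm₂.Γ (Sum.elim (fun _ => A) fun _ => B ⊕ C))
  let σ : Type := (tm₁.σ × tm₂.σ) × Option (A ⊕ B ⊕ C)
  let e₁ : tm₁.K → K := Sum.inl
  let e₂ : tm₂.K → K := fun k => Sum.inr (Sum.inl k)
  let x : Bool → K := fun b => Sum.inr (Sum.inr (Sum.inl b))
  let y : Bool → K := fun b => Sum.inr (Sum.inr (Sum.inr b))
  let π₁ : Part σ tm₁.σ := (Part.fst _ _).comp (Part.fst _ _)
  let π₂ : Part σ tm₂.σ := (Part.fst _ _).comp (Part.snd _ _)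
  have hxy : ∀ b b', x b ≠ y b' :=
    fun b b' h => nomatch Sum.inr_injective (Sum.inr_injective h)
  have hxx : x false ≠ x true :=
    fun h => nomatch Sum.inl_injective (Sum.inr_injective (Sum.inr_injective h))
  have hyy : y false ≠ y true :=
    fun h => nomatch Sum.inr_injective (Sum.inr_injective (Sum.inr_injective h))
  have hx₁ : ∀ b k, x b ≠ e₁ k := nofun
  have hx₂ : ∀ b k, x b ≠ e₂ k := fun b k h => nomatch Sum.inr_injective h
  have hy₁ : ∀ b k, y b ≠ e₁ k := nofun
  have hy₂ : ∀ b k, y b ≠ e₂ k := fun b k h => nomatch Sum.inr_injective h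
  have h₁₂ : ∀ k k', e₁ k ≠ e₂ k' := nofun
  have he₁ : e₁.Injective := Sum.inl_injective
  have he₂ : e₂.Injective := Sum.inr_injective.comp Sum.inl_injective
  let rA : A ⊕ B ⊕ C → List A := Sum.elim (fun a => [a]) fun _ => []
  let rD : A ⊕ B ⊕ C → List (B ⊕ C) := Sum.elim (fun _ => []) fun d => [d]
  let D₁ : Flow Γ σ := Flow.drain (x false) (fun a : A => Sum.inl a) fun r => single (x true) (rA r)
  let D₂ : Flow Γ σ := Flow.drain (x true) (fun a : A => Sum.inl a) fun r k' =>
    single (e₁ tm₁.k₀) ((rA r).map i₀.symm) k' ++ single (e₂ tm₂.k₀) ((rA r).map j₀.symm) k'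
  let F₁ : Flow Γ σ := Flow.lift e₁ π₁ (Flow.ofTM tm₁ tm₁.main fun _ => False)
  let F₂ : Flow Γ σ := Flow.lift e₂ π₂ (Flow.ofTM tm₂ tm₂.main fun _ => False)
  let D₃ : Flow Γ σ := Flow.drain (e₁ tm₁.k₁) (fun b => Sum.inr (Sum.inl (i₁ b)))
    fun r => single (y false) (rD r)
  let D₄ : Flow Γ σ := Flow.drain (e₂ tm₂.k₁) (fun b => Sum.inr (Sum.inr (j₁ b)))
    fun r => single (y false) (rD r)
  let D₅ : Flow Γ σ := Flow.drain (y false) (fun d => Sum.inr d) fun r => single (y true) (rD r)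
  have : Fintype (Γ (x false)) := fA
  refine polyTime_of_flow (Γ := Γ)
    (D₁.seq (D₂.seq (F₁.seq (F₂.seq (D₃.seq (D₄.seq D₅)))))) (x false) (y true)
    (Equiv.refl A) (Equiv.refl (B ⊕ C)) ((tm₁.initialState, tm₂.initialState), none)
    ((Polynomial.X + 1) + ((Polynomial.X + 1) + (p₁ + (p₂ + ((q₁ + 1) + ((q₂ + 1) +
      (q₁ + q₂ + 1))))))) fun a => ?_
  obtain ⟨n₁, hn₁, hr₁⟩ := h₁ a
  obtain ⟨n₂, hn₂, hr₂⟩ := h₂ a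
  let v : tm₁.σ × tm₂.σ := (tm₁.initialState, tm₂.initialState)
  let S₀ : Stk Γ := single (x false) ((ea a).map (Equiv.refl A).symm)
  have hS₀ : S₀ (x false) = ea a := (single_self _ _).trans (List.map_id _)
  have hS₀' : ∀ k, k ≠ x false → S₀ k = [] := fun k hk => single_of_ne hk _
  obtain ⟨S₁, r₁, hS₁t, -, hS₁⟩ := Flow.runs_move (Γ := Γ) (k := x false) (t := x true) hxx
    (fun a : A => (Sum.inl a : A ⊕ B ⊕ C)) rA (fun a => a) (fun _ => rfl) v none S₀
  have hS₁t' : S₁ (x true) = (ea a).reverse := by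
    rw [hS₁t, hS₀, hS₀' _ hxx.symm]; exact reverse_map_self_append_nil _
  have hS₁' : ∀ k, k ≠ x false → k ≠ x true → S₁ k = [] := fun k hk hk' => by
    rw [hS₁ k hk hk', hS₀' k hk]
  obtain ⟨S₂, r₂, hS₂a, hS₂b, -, hS₂⟩ := Flow.runs_split (Γ := Γ) (k := x true)
    (t₁ := e₁ tm₁.k₀) (t₂ := e₂ tm₂.k₀) (hx₁ _ _) (hx₂ _ _) (h₁₂ _ _)
    (fun a : A => (Sum.inl a : A ⊕ B ⊕ C)) (fun r => (rA r).map i₀.symm)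
    (fun r => (rA r).map j₀.symm) v none S₁
  rw [hS₁t', hS₁' _ (hx₁ _ _).symm (hx₁ _ _).symm] at hS₂a
  rw [hS₁t', hS₁' _ (hx₂ _ _).symm (hx₂ _ _).symm] at hS₂b
  have hS₂' : ∀ k, (∀ b, k ≠ x b) → k ≠ e₁ tm₁.k₀ → k ≠ e₂ tm₂.k₀ → S₂ k = [] :=
    fun k h h' h'' => by rw [hS₂ k (h _) h' h'', hS₁' k (h _) (h _)]
  obtain ⟨S₃, r₃, hS₃t, hS₃⟩ := Flow.Runs.subroutine (Γ := Γ) he₁ π₁ hr₁ (v := (v, none)) (S := S₂)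
    rfl (hS₂a.trans (flatMap_reverse_map_reverse _ _))
    (fun k hk => hS₂' _ (fun b => (hx₁ b _).symm) (fun h => hk (he₁ h)) (h₁₂ _ _))
  obtain ⟨S₄, r₄, hS₄t, hS₄⟩ := Flow.Runs.subroutine (Γ := Γ) he₂ π₂ hr₂ (v := (v, none)) (S := S₃)
    rfl ((hS₃ _ fun k => h₁₂ _ _).trans (hS₂b.trans (flatMap_reverse_map_reverse _ _)))
    (fun k hk => (hS₃ _ fun k => h₁₂ _ _).trans
      (hS₂' _ (fun b => (hx₂ b _).symm) (h₁₂ _ _).symm (fun h => hk (he₂ h))))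
  have hS₄y : ∀ b, S₄ (y b) = [] := fun b => by
    rw [hS₄ _ fun k => (hy₂ b k).symm, hS₃ _ fun k => (hy₁ b k).symm,
      hS₂' _ (fun b' => (hxy _ _).symm) (hy₁ _ _) (hy₂ _ _)]
  have hS₄x : S₄ (e₁ tm₁.k₁) = (F a).map i₁.symm := by
    rw [hS₄ _ fun k => (h₁₂ _ _).symm]; exact hS₃t
  obtain ⟨S₅, r₅, hS₅t, -, hS₅⟩ := Flow.runs_move (Γ := Γ) (k := e₁ tm₁.k₁) (t := y false)
    (hy₁ _ _).symm (fun b => (Sum.inr (Sum.inl (i₁ b)) : A ⊕ B ⊕ C)) rD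
    (fun b => (Sum.inl (i₁ b) : B ⊕ C)) (fun _ => rfl) v none S₄
  rw [hS₄x, hS₄y] at hS₅t
  obtain ⟨S₆, r₆, hS₆t, -, hS₆⟩ := Flow.runs_move (Γ := Γ) (k := e₂ tm₂.k₁) (t := y false)
    (hy₂ _ _).symm (fun b => (Sum.inr (Sum.inr (j₁ b)) : A ⊕ B ⊕ C)) rD
    (fun b => (Sum.inr (j₁ b) : B ⊕ C)) (fun _ => rfl) v none S₅
  have hS₅x : S₅ (e₂ tm₂.k₁) = (G a).map j₁.symm := by
    rw [hS₅ _ (h₁₂ _ _).symm (hy₂ _ _).symm]; exact hS₄t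
  rw [hS₅x, hS₅t] at hS₆t
  have hS₆t' : S₆ (y false) =
      ((G a).map (Sum.inr : C → B ⊕ C)).reverse ++ ((F a).map Sum.inl).reverse := by
    rw [hS₆t]
    exact congrArg₂ _ (congrArg List.reverse (map_inr_map j₁ _ _))
      ((List.append_nil _).trans (congrArg List.reverse (map_inr_map i₁ _ _)))
  obtain ⟨S₇, r₇, hS₇t, -, -⟩ := Flow.runs_move (Γ := Γ) (k := y false) (t := y true)
    hyy (fun d => (Sum.inr d : A ⊕ B ⊕ C)) rD (fun d => d) (fun _ => rfl) v none S₆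
  rw [hS₆t', hS₆ _ (hy₂ _ _) hyy.symm, hS₅ _ (hy₁ _ _) hyy.symm, hS₄y] at hS₇t
  refine ⟨_, _, _, ?_, r₁.seq (r₂.seq (r₃.seq (r₄.seq (r₅.seq (r₆.seq r₇))))),
    hS₇t.trans ((reverse_map_append_reverse _ _ _ _).trans (List.map_id _).symm)⟩
  have l₁ : (S₀ (x false)).length = (ea a).length := congrArg List.length hS₀
  have l₂ : (S₁ (x true)).length = (ea a).length := by rw [hS₁t']; exact List.length_reverse
  have l₃ : (S₄ (e₁ tm₁.k₁)).length = (F a).length := by rw [hS₄x]; exact List.length_map _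
  have l₄ : (S₅ (e₂ tm₂.k₁)).length = (G a).length := by rw [hS₅x]; exact List.length_map _
  have l₅ : (S₆ (y false)).length = (G a).length + (F a).length := by
    rw [hS₆t']
    exact length_reverse_map_append _ _ _ _
  rw [l₁, l₂, l₃, l₄, l₅]
  have := hq₁ a
  have := hq₂ a
  simp only [Polynomial.eval_add, Polynomial.eval_one, Polynomial.eval_X, id] at *
  omega

end QueryOrder

namespace QueryOrder

open Turing

/-! ### Finite-state transducers -/

/-- The output of a transducer with transition function `δ`, output function `out` and final output
`fin`, started in the given state. -/
def mealy {s A B : Type} (δ : s → A → s) (out : s → A → List B) (fin : s → List B) :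
    s → List A → List B
  | q, [] => fin q
  | q, a :: l => out q a ++ mealy δ out fin (δ q a) l

section Transduce

variable {K : Type} [DecidableEq K] [Fintype K] {Γ : K → Type} {s A ι R : Type}
  [Fintype s] [Fintype A] [Fintype ι] [Fintype R]

/-- Empty the stack `k`, writing the output of a transducer to the stack `t`. -/
noncomputable def Flow.transduce (k t : K) (ρ : Γ k → A) (δ : s → A → s)
    (out : s → A → List (Γ t)) (fin : s → List (Γ t)) :
    Flow Γ (((s × Option A) × ι) × Option R) :=
  Flow.scan k
    (fun o v => (((v.1.1.2.elim v.1.1.1 (δ v.1.1.1), o.map ρ), v.1.2), v.2))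
    (fun v => single t (v.1.1.2.elim (fin v.1.1.1) (out v.1.1.1)))
    (fun v => v.1.1.2.isSome)

/-- The symbol just read is kept in the state and its transition is postponed to the next pop,
because the output function needs the state before the transition. -/
theorem Flow.runs_transduce {k t : K} (hkt : k ≠ t) (ρ : Γ k → A) (δ : s → A → s)
    (out : s → A → List (Γ t)) (fin : s → List (Γ t)) (q : s) (i : ι) (r : Option R) (S : Stk Γ) :
    ∃ q' S', (transduce k t ρ δ out fin).Runs (((q, none), i), r) S ((S k).length + 1)
        (((q', none), i), r) S' ∧
      S' t = (mealy δ out fin q ((S k).map ρ)).reverse ++ S t ∧ S' k = [] ∧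
      ∀ k', k' ≠ k → k' ≠ t → S' k' = S k' := by
  have h := runs_scan (k := k) (σ := ((s × Option A) × ι) × Option R)
    (rd := fun o v => (((v.1.1.2.elim v.1.1.1 (δ v.1.1.1), o.map ρ), v.1.2), v.2))
    (emit := fun v => single t (v.1.1.2.elim (fin v.1.1.1) (out v.1.1.1)))
    (more := fun v => v.1.1.2.isSome) (by simp) (by simp) (by simp [hkt])
    (((q, none), i), r) S
  have e₁ : ∀ (l : List (Γ k)) (o : Option A) (q : s), ∃ q' o',
      l.foldl (fun (v : ((s × Option A) × ι) × Option R) a =>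
        (((v.1.1.2.elim v.1.1.1 (δ v.1.1.1), (some a).map ρ), v.1.2), v.2)) (((q, o), i), r) =
      (((q', o'), i), r) := by
    intro l
    induction l with
    | nil => exact fun o q => ⟨q, o, rfl⟩
    | cons a l ih => exact fun o q => ih _ _
  have e₂ : ∀ (k' : K) (l : List (Γ k)) (o : Option A) (q : s),
      scanOut (fun o (v : ((s × Option A) × ι) × Option R) =>
          (((v.1.1.2.elim v.1.1.1 (δ v.1.1.1), o.map ρ), v.1.2), v.2))
        (fun v => single t (v.1.1.2.elim (fin v.1.1.1) (out v.1.1.1))) (((q, o), i), r) l k' =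
      single t (mealy δ out fin (o.elim q (δ q)) (l.map ρ)) k' := by
    intro k' l
    induction l with
    | nil => exact fun o q => rfl
    | cons a l ih =>
      intro o q
      by_cases hk' : k' = t
      · subst hk'; simp [scanOut, ih, mealy]
      · simp [scanOut, ih, hk']
  obtain ⟨q', o', hq⟩ := e₁ (S k) none q
  rw [hq] at h
  simp only [e₂] at h
  exact ⟨_, _, h, by simp [hkt.symm], by simp [hkt], fun k' h₁ h₂ => by simp [h₁, h₂]⟩

end Transduce

theorem reverse_mealy_append_nil {s A B : Type} (δ : s → A → s) (out : s → A → List B)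
    (fin : s → List B) (q : s) {x y : List A} {z : List B} (hy : y = x) (hz : z = []) :
    (mealy δ out fin q (y.map fun a => a)).reverse ++ z = (mealy δ out fin q x).reverse := by
  rw [hy, hz, List.append_nil, List.map_id']

theorem reverse_map_self_append {B : Type} {w y z : List B} (hy : y = w.reverse) (hz : z = []) :
    (y.map fun b => b).reverse ++ z = w := by
  rw [hy, hz, List.append_nil, List.map_id', List.reverse_reverse]

theorem length_mealy_le {s A B : Type} [Fintype s] [Fintype A] (δ : s → A → s)
    (out : s → A → List B) (fin : s → List B) :
    ∃ C, ∀ q l, (mealy δ out fin q l).length ≤ C * (l.length + 1) := by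
  refine ⟨(Finset.univ.sup fun q => (fin q).length) +
    Finset.univ.sup fun q : s × A => (out q.1 q.2).length, fun q l => ?_⟩
  have h₁ : ∀ q, (fin q).length ≤ Finset.univ.sup fun q => (fin q).length := fun q =>
    Finset.le_sup (f := fun q => (fin q).length) (Finset.mem_univ q)
  have h₂ : ∀ q a, (out q a).length ≤
      Finset.univ.sup fun q : s × A => (out q.1 q.2).length := fun q a =>
    Finset.le_sup (f := fun q : s × A => (out q.1 q.2).length) (Finset.mem_univ (q, a))
  induction l generalizing q with
  | nil => simpa [mealy] using (h₁ q).trans (Nat.le_add_right _ _)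
  | cons a l ih =>
    have := h₂ q a
    have := ih (δ q a)
    simp only [mealy, List.length_append, List.length_cons]
    rw [Nat.mul_succ]
    omega

theorem polyTime_mealy {s A B : Type} [Fintype s] [Fintype A] [Fintype B] (δ : s → A → s)
    (out : s → A → List B) (fin : s → List B) (q : s) : PT id (mealy δ out fin q) := by
  obtain ⟨C, hC⟩ := length_mealy_le δ out fin
  let Γ : Option Bool → Type := fun k => k.elim A fun _ => B
  have : Fintype (Γ none) := ‹Fintype A›
  refine polyTime_of_flow (Γ := Γ) (σ := ((s × Option A) × Unit) × Option B)
    ((Flow.transduce none (some false) (fun a : A => a) δ out fin).seq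
      (Flow.drain (some false) (fun b : B => b) fun b => single (some true) [b]))
    none (some true) (Equiv.refl A) (Equiv.refl B) (((q, none), ()), none)
    ((Polynomial.X + 1) + (Polynomial.C C * (Polynomial.X + 1) + 1)) fun x => ?_
  have h₀ : single (Γ := Γ) none (x.map (Equiv.refl A).symm) none = x :=
    (single_self _ _).trans (List.map_id _)
  obtain ⟨q', S₁, r₁, hS₁, -, hS₁'⟩ := Flow.runs_transduce (Γ := Γ) (k := none) (t := some false)
    (A := A) (ι := Unit) (R := B) (by simp) (fun a : A => a) δ out fin q () none
    (single none (x.map (Equiv.refl A).symm))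
  obtain ⟨S₂, r₂, hS₂, -, -⟩ := Flow.runs_move (Γ := Γ) (k := some false) (t := some true)
    (τ := (s × Option A) × Unit)
    (R := B) (by simp) (fun b : B => b) (fun b => [b]) (fun b => b) (fun _ => rfl)
    ((q', none), ()) none S₁
  have e₁ : S₁ (some false) = (mealy δ out fin q x).reverse :=
    hS₁.trans (reverse_mealy_append_nil δ out fin q h₀ (single_of_ne (by simp) _))
  have e₂ : S₂ (some true) = mealy δ out fin q x :=
    hS₂.trans (reverse_map_self_append e₁ ((hS₁' _ (by simp) (by simp)).trans
      (single_of_ne (by simp) _)))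
  refine ⟨_, _, _, ?_, r₁.seq r₂, e₂.trans (List.map_id _).symm⟩
  have l₁ : (S₁ (some false)).length ≤ C * (x.length + 1) :=
    (congrArg List.length e₁).trans_le (List.length_reverse.trans_le (hC q x))
  have l₀ : (single (Γ := Γ) none (x.map (Equiv.refl A).symm) none).length = x.length :=
    congrArg _ h₀
  simp only [Polynomial.eval_add, Polynomial.eval_mul, Polynomial.eval_C, Polynomial.eval_X,
    Polynomial.eval_one, id, l₀] at *
  omega

theorem PT.mealy {α s A B C : Type} [Fintype s] [Fintype A] [Fintype B] {ea : α → List C}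
    {F : α → List A} (h : PT ea F) (δ : s → A → s) (out : s → A → List B) (fin : s → List B)
    (q : s) : PT ea fun a => mealy δ out fin q (F a) :=
  PT.comp (eb := id) h (polyTime_mealy δ out fin q)

end QueryOrder

/-! ### Iterating a transducer a unary-given number of times -/

namespace QueryOrder

open Turing

theorem flatMap_elim_left {A B : Type} (l : List B) (l' : List A) {z : List Unit} (hz : z = []) :
    ((l.map (Sum.inl : B → B ⊕ A) ++ l'.map Sum.inr).flatMap
      fun r => Sum.elim (fun _ => [()]) (fun _ => []) r).reverse ++ z =
      List.replicate l.length () := by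
  subst hz
  refine List.eq_replicate_iff.mpr ⟨?_, fun _ _ => rfl⟩
  simp [List.flatMap_map]

theorem flatMap_elim_right {A B : Type} (l : List B) (l' : List A) {z : List A} (hz : z = []) :
    ((l.map (Sum.inl : B → B ⊕ A) ++ l'.map Sum.inr).flatMap
      fun r => Sum.elim (fun _ => []) (fun a => [a]) r).reverse ++ z = l'.reverse := by
  subst hz
  simp [List.flatMap_map]

/-- A unary counter on the stack `u` is popped once per pass. Since a single pass may multiply the
length by a constant, `hp` is needed to exclude exponential growth. -/
theorem PT.iterate {α s A B C : Type} [Fintype s] [Fintype A] [Fintype B] {ea : α → List C}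
    {U : α → List B} {W : α → List A} (hU : PT ea U) (hW : PT ea W) (δ : s → A → s)
    (out : s → A → List A) (fin : s → List A) (q₀ : s) (p : Polynomial ℕ)
    (hp : ∀ i w, ((QueryOrder.mealy δ out fin q₀)^[i] w).length ≤ p.eval (i + w.length)) :
    PT ea fun a => (QueryOrder.mealy δ out fin q₀)^[(U a).length] (W a) := by
  set T := QueryOrder.mealy δ out fin q₀ with hT
  refine PT.comp (eb := fun a => (U a).map (Sum.inl : B → B ⊕ A) ++ (W a).map Sum.inr) (f := id)
    (G := fun a => T^[(U a).length] (W a)) (hU.pair hW) ?_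
  let Γ : Option (Option Bool) → Type := fun k => k.elim (B ⊕ A) fun k => k.elim Unit fun _ => A
  have : Fintype (Γ none) := instFintypeSum B A
  let u : Option (Option Bool) := some none
  let x : Option (Option Bool) := some (some true)
  let y : Option (Option Bool) := some (some false)
  let σ : Type := ((s × Option A) × Bool) × Option (B ⊕ A)
  let D₁ : Flow Γ σ := Flow.drain none (fun r : B ⊕ A => r) fun r k' =>
    single u (Sum.elim (fun _ => [()]) (fun _ => []) r) k' ++
      single y (Sum.elim (fun _ => []) (fun a => [a]) r) k'
  let D₂ : Flow Γ σ := Flow.drain y (fun a : A => (Sum.inr a : B ⊕ A)) fun r =>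
    single x (Sum.elim (fun _ => []) (fun a => [a]) r)
  -- The test also puts the transducer back into `q₀`, whatever state the previous pass ended in.
  let t : TM2.Stmt Γ Bool σ := .pop u (fun v o => (((q₀, none), o.isSome), v.2))
    (.goto fun v => v.1.2)
  let L : Flow Γ σ := Flow.loop t ((Flow.transduce x y (fun a : A => a) δ out fin).seq D₂)
  -- A round consists of one test, one scan and one drain of words of length at most `M`: `1 + (M +
  -- 1) + (M + 1)` steps.
  have key : ∀ (n : ℕ) (w : List A) (M : ℕ) (v : σ) (S : Stk Γ),
      (∀ i ≤ n, (T^[i] w).length ≤ M) → S u = List.replicate n () → S x = w → S y = [] →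
      ∃ m v' S', m ≤ n * (2 * M + 3) + 1 ∧ L.Runs v S m v' S' ∧ S' x = T^[n] w := by
    intro n
    induction n with
    | zero =>
      intro w M v S _ hu hx hy
      refine ⟨1, (((q₀, none), false), v.2), Function.update S u (S u).tail, by omega,
        Flow.Runs.loop_exit ?_, ?_⟩
      · simp only [t, TM2.stepAux]
        rw [show (S u).head? = none by rw [hu]; rfl]
        rfl
      · exact (Function.update_of_ne (by simp [x, u]) _ _).trans hx
    | succ n ih =>
      intro w M v S hM hu hx hy
      let S₁ : Stk Γ := Function.update S u (S u).tail
      have h₁u : S₁ u = List.replicate n () :=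
        (Function.update_self _ _ _).trans (congrArg List.tail hu)
      have h₁ : ∀ k, k ≠ u → S₁ k = S k := fun k hk => Function.update_of_ne hk _ _
      obtain ⟨q', S₂, r₂, hS₂, hS₂x, hS₂'⟩ := Flow.runs_transduce (Γ := Γ) (k := x) (t := y)
        (A := A) (by simp [x, y]) (fun a : A => a) δ out fin q₀ true v.2 S₁
      obtain ⟨S₃, r₃, hS₃, hS₃y, hS₃'⟩ := Flow.runs_move (Γ := Γ) (k := y) (t := x)
        (τ := (s × Option A) × Bool) (by simp [x, y]) (fun a : A => (Sum.inr a : B ⊕ A))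
        (fun r => Sum.elim (fun _ => []) (fun a => [a]) r) (fun a => a) (fun _ => rfl)
        ((q', none), true) v.2 S₂
      have h₁x : S₁ x = w := (h₁ _ (by simp [x, u])).trans hx
      have e₂ : S₂ y = (T w).reverse := hS₂.trans (reverse_mealy_append_nil δ out fin q₀
        h₁x ((h₁ _ (by simp [y, u])).trans hy))
      have e₃ : S₃ x = T w := hS₃.trans (reverse_map_self_append e₂ hS₂x)
      obtain ⟨m, v', S', hm, hr, hS'⟩ := ih (T w) M (((q', none), true), none) S₃
        (fun i hi => hM (i + 1) (by omega))
        (((hS₃' _ (by simp [u, y]) (by simp [u, x])).trans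
          (hS₂' _ (by simp [u, x]) (by simp [u, y]))).trans h₁u) e₃ hS₃y
      refine ⟨_, v', S', ?_, Flow.Runs.loop_step (v₁ := (((q₀, none), true), v.2)) (S₁ := S₁) ?_
        (r₂.seq r₃) hr, hS'⟩
      · have l₁ : (S₁ x).length ≤ M := by rw [h₁x]; exact hM 0 (by omega)
        have l₂ : (S₂ y).length ≤ M := (congrArg List.length e₂).trans_le
          (List.length_reverse.trans_le (hM 1 (by omega)))
        rw [Nat.succ_mul]
        omega
      · simp only [t, TM2.stepAux]
        rw [show (S u).head? = some () by rw [hu]; rfl]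
        rfl
  refine polyTime_of_flow (Γ := Γ) (D₁.seq (D₂.seq L)) none x (Equiv.refl (B ⊕ A)) (Equiv.refl A)
    (((q₀, none), false), none)
    ((Polynomial.X + 1) + ((Polynomial.X + 1) + (Polynomial.X * (2 * p + 3) + 1))) fun a => ?_
  have h₀ : single (Γ := Γ) none (((U a).map Sum.inl ++ (W a).map Sum.inr).map
      (Equiv.refl (B ⊕ A)).symm) none = (U a).map Sum.inl ++ (W a).map Sum.inr :=
    (single_self _ _).trans (List.map_id _)
  obtain ⟨S₁, r₁, hS₁u, hS₁y, -, hS₁⟩ := Flow.runs_split (Γ := Γ) (k := none) (t₁ := u) (t₂ := y)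
    (τ := (s × Option A) × Bool) (by simp [u]) (by simp [y]) (by simp [u, y]) (fun r : B ⊕ A => r)
    (fun r => Sum.elim (fun _ => [()]) (fun _ => []) r)
    (fun r => Sum.elim (fun _ => []) (fun a => [a]) r) ((q₀, none), false) none
    (single none (((U a).map Sum.inl ++ (W a).map Sum.inr).map (Equiv.refl (B ⊕ A)).symm))
  rw [h₀] at hS₁u hS₁y
  have e₁u := hS₁u.trans (flatMap_elim_left _ _ (single_of_ne (by simp [u]) _))
  have e₁y := hS₁y.trans (flatMap_elim_right _ _ (single_of_ne (by simp [y]) _))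
  have e₁x : S₁ x = [] := (hS₁ _ (by simp [x]) (by simp [x, u]) (by simp [x, y])).trans
    (single_of_ne (by simp [x]) _)
  obtain ⟨S₂, r₂, hS₂x, hS₂y, hS₂⟩ := Flow.runs_move (Γ := Γ) (k := y) (t := x)
    (τ := (s × Option A) × Bool) (by simp [x, y]) (fun a : A => (Sum.inr a : B ⊕ A))
    (fun r => Sum.elim (fun _ => []) (fun a => [a]) r) (fun a => a) (fun _ => rfl)
    ((q₀, none), false) none S₁
  have e₂x : S₂ x = W a := hS₂x.trans (reverse_map_self_append e₁y e₁x)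
  obtain ⟨m, v', S₃, hm, r₃, e₃⟩ := key (U a).length (W a)
    (p.eval ((U a).length + (W a).length)) (((q₀, none), false), none) S₂
    (fun i hi => (hp i _).trans (eval_mono p (by omega)))
    ((hS₂ _ (by simp [u, y]) (by simp [u, x])).trans e₁u) e₂x hS₂y
  refine ⟨_, _, _, ?_, r₁.seq (r₂.seq r₃), e₃.trans (List.map_id _).symm⟩
  have hlen : ((U a).map (Sum.inl : B → B ⊕ A) ++ (W a).map Sum.inr).length =
      (U a).length + (W a).length := by simp
  have l₁ : (S₁ y).length = (W a).length := (congrArg List.length e₁y).trans List.length_reverse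
  have : (U a).length * (2 * p.eval ((U a).length + (W a).length) + 3) ≤
      ((U a).length + (W a).length) * (2 * p.eval ((U a).length + (W a).length) + 3) := by
    gcongr; omega
  have l₀ : (single (Γ := Γ) none (((U a).map Sum.inl ++ (W a).map Sum.inr).map
      (Equiv.refl (B ⊕ A)).symm) none).length = (U a).length + (W a).length :=
    (congrArg List.length h₀).trans hlen
  simp only [Polynomial.eval_add, Polynomial.eval_mul, Polynomial.eval_X, Polynomial.eval_one,
    Polynomial.eval_ofNat, hlen, l₁, l₀]
  omega

end QueryOrder

namespace QueryOrder

open Turing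

/-! ### A toolkit of polynomial-time string functions -/

section Toolkit

variable {α A B C : Type} {ea : α → List A}

theorem PT.self [Fintype A] : PT ea ea :=
  polyTime_iff_PT.mp ⟨idComputableInPolyTime ea⟩

theorem mealy_unit (g : B → List C) (l : List B) :
    mealy (fun _ _ => ()) (fun _ b => g b) (fun _ => []) () l = l.flatMap g := by
  induction l with
  | nil => rfl
  | cons b l ih => simp [mealy, ih]

theorem PT.flatMap [Fintype B] [Fintype C] {F : α → List B} (h : PT ea F) (g : B → List C) :
    PT ea fun a => (F a).flatMap g := by
  simpa only [mealy_unit] using h.mealy (fun (_ : Unit) _ => ()) (fun _ b => g b) (fun _ => []) ()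

theorem PT.map [Fintype B] [Fintype C] {F : α → List B} (h : PT ea F) (g : B → C) :
    PT ea fun a => (F a).map g := by
  simpa only [List.map_eq_flatMap] using h.flatMap fun b => [g b]

theorem PT.const [Fintype A] [Fintype B] (l : List B) : PT ea fun _ => l := by
  have h : ∀ l' : List A, QueryOrder.mealy (fun (_ : Unit) _ => ()) (fun _ _ => [])
      (fun _ => l) () l' = l := by
    intro l'
    induction l' with
    | nil => rfl
    | cons a l' ih => simpa [QueryOrder.mealy] using ih
  simpa only [h] using
    (PT.self (ea := ea)).mealy (fun (_ : Unit) _ => ()) (fun _ _ => []) (fun _ => l) ()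

theorem PT.append [Fintype B] {F G : α → List B} (hF : PT ea F) (hG : PT ea G) :
    PT ea fun a => F a ++ G a := by
  simpa [List.flatMap_map] using (hF.pair hG).flatMap (Sum.elim (fun b => [b]) fun b => [b])

theorem PT.bool₂ {f g : α → Bool} (hf : PT ea fun a => [f a]) (hg : PT ea fun a => [g a])
    (op : Bool → Bool → Bool) : PT ea fun a => [op (f a) (g a)] := by
  simpa [QueryOrder.mealy] using (hf.append hg).mealy (fun (q : Option Bool) b => some (q.getD b))
    (fun q b => q.elim [] fun a => [op a b]) (fun _ => []) none

theorem mealy_tail (l : List B) :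
    mealy (fun _ _ => true) (fun q b => if q then [b] else []) (fun _ => []) false l =
      l.tail := by
  have : ∀ l : List B, mealy (fun _ _ => true) (fun q b => if q then [b] else []) (fun _ => [])
      true l = l := by
    intro l
    induction l with
    | nil => rfl
    | cons b l ih => simp [mealy, ih]
  cases l with
  | nil => rfl
  | cons b l => simp [mealy, this]

theorem PT.tail [Fintype B] {F : α → List B} (h : PT ea F) : PT ea fun a => (F a).tail := by
  simpa only [mealy_tail] using
    h.mealy (fun (_ : Bool) _ => true) (fun q b => if q then [b] else []) (fun _ => []) false

theorem PT.head? [Fintype B] [DecidableEq B] {F : α → List B} (h : PT ea F) (o : Option B) :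
    PT ea fun a => [decide ((F a).head? = o)] := by
  have h₁ : ∀ (l : List B) (b : B), QueryOrder.mealy (fun (q : Option B) a => some (q.getD a))
      (fun _ _ => []) (fun q => [decide (q = o)]) (some b) l = [decide (some b = o)] := by
    intro l b
    induction l with
    | nil => rfl
    | cons c l ih => simpa [QueryOrder.mealy] using ih
  have h₂ : ∀ l : List B, QueryOrder.mealy (fun (q : Option B) a => some (q.getD a))
      (fun _ _ => []) (fun q => [decide (q = o)]) none l = [decide (l.head? = o)] := by
    intro l
    cases l with
    | nil => rfl
    | cons b l => exact h₁ l b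
  simpa only [h₂] using h.mealy (fun (q : Option B) a => some (q.getD a))
    (fun _ _ => []) (fun q => [decide (q = o)]) none

/-- Iterating the transducer for `tail` once per symbol of `G a` empties `F a` exactly when `F a` is
not longer. -/
theorem PT.length_le [Fintype B] [Fintype C] {F : α → List B} {G : α → List C} (hF : PT ea F)
    (hG : PT ea G) : PT ea fun a => [decide ((F a).length ≤ (G a).length)] := by
  classical
  have e : ∀ (n : ℕ) (l : List B), (QueryOrder.mealy (fun _ _ => true)
      (fun q b => if q then [b] else []) (fun _ => []) false)^[n] l = l.drop n := by
    intro n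
    induction n with
    | zero => simp
    | succ n ih => intro l; rw [Function.iterate_succ_apply, ih, mealy_tail, List.drop_tail]
  have h := PT.iterate hG hF (fun (_ : Bool) _ => true) (fun q b => if q then [b] else [])
    (fun _ => []) false Polynomial.X (fun i w => by rw [e]; simp; omega)
  simp only [e] at h
  simpa [List.head?_eq_none_iff] using h.head? none

/-- The number `N a` can be computed in unary, in polynomial time. -/
def UnaryPT (ea : α → List A) (N : α → ℕ) : Prop :=
  ∃ F : α → List Bool, PT ea F ∧ ∀ a, (F a).length = N a

theorem PT.unary [Fintype B] {F : α → List B} (h : PT ea F) : UnaryPT ea fun a => (F a).length :=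
  ⟨_, h.map fun _ => true, fun a => by simp⟩

theorem UnaryPT.add {M N : α → ℕ} (hM : UnaryPT ea M) (hN : UnaryPT ea N) :
    UnaryPT ea fun a => M a + N a := by
  obtain ⟨F, hF, hF'⟩ := hM
  obtain ⟨G, hG, hG'⟩ := hN
  exact ⟨_, hF.append hG, fun a => by simp [hF', hG']⟩

/-- Start from `N a` copies of `false`; in each of `M a` passes every `false` emits one new `true`.
The final number of `true`s is the product. -/
theorem UnaryPT.mul {M N : α → ℕ} (hM : UnaryPT ea M) (hN : UnaryPT ea N) :
    UnaryPT ea fun a => M a * N a := by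
  obtain ⟨F, hF, hF'⟩ := hM
  obtain ⟨G, hG, hG'⟩ := hN
  let g : Bool → List Bool := fun b => if b then [true] else [false, true]
  have e₀ : ∀ w : List Bool, (w.flatMap g).count false = w.count false ∧
      (w.flatMap g).count true = w.count true + w.count false := by
    intro w
    induction w with
    | nil => simp
    | cons b w ih =>
      rw [List.flatMap_cons, List.count_append, List.count_append, ih.1, ih.2]
      have := List.count_false_add_count_true w
      cases b <;> simp [g] <;> omega
  have e : ∀ (n : ℕ) (w : List Bool),
      ((mealy (fun _ _ => ()) (fun _ b => g b) (fun _ => []) ())^[n] w).count false =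
        w.count false ∧
      ((mealy (fun _ _ => ()) (fun _ b => g b) (fun _ => []) ())^[n] w).count true =
        w.count true + n * w.count false := by
    intro n
    induction n with
    | zero => simp
    | succ n ih =>
      intro w
      rw [Function.iterate_succ_apply, mealy_unit]
      rw [(ih _).1, (ih _).2, (e₀ w).1, (e₀ w).2]
      constructor <;> ring
  have h := PT.iterate hF (hG.map fun _ => false) (fun (_ : Unit) _ => ()) (fun _ b => g b)
    (fun _ => []) () ((Polynomial.X + 1) * Polynomial.X) (fun i w => by
      rw [← List.count_false_add_count_true, (e i w).1, (e i w).2]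
      have := List.count_false_add_count_true w
      simp only [Polynomial.eval_mul, Polynomial.eval_add, Polynomial.eval_X, Polynomial.eval_one]
      nlinarith)
  refine ⟨_, h.flatMap fun b => if b then [true] else [], fun a => ?_⟩
  have e₁ : ∀ w : List Bool, (w.flatMap fun b => if b then [true] else []).length =
      w.count true := by
    intro w
    induction w with
    | nil => simp
    | cons b w ih => cases b <;> simp [ih]
  rw [e₁, (e _ _).2]
  simp [hF', hG', List.count_replicate, List.map_const']

theorem UnaryPT.eval [Fintype A] {N : α → ℕ} (hN : UnaryPT ea N) (p : Polynomial ℕ) :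
    UnaryPT ea fun a => p.eval (N a) := by
  induction p using Polynomial.induction_on with
  | C n => exact ⟨_, PT.const (List.replicate n true), fun a => by simp⟩
  | add p q hp hq => simpa using hp.add hq
  | monomial n c h => simpa [pow_succ, mul_assoc] using h.mul hN

theorem UnaryPT.length_le [Fintype B] {N : α → ℕ} (hN : UnaryPT ea N) {F : α → List B}
    (hF : PT ea F) : PT ea fun a => [decide ((F a).length ≤ N a)] := by
  obtain ⟨G, hG, hG'⟩ := hN
  simpa only [hG'] using PT.length_le hF hG

end Toolkit

theorem PT.fst : PT encPair Prod.fst := by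
  have h₁ : ∀ l : List Bool, QueryOrder.mealy (fun (q : Bool) (o : Option Bool) => q || o.isNone)
      (fun q o => if q then [] else o.toList) (fun _ => []) true (l.map some) = [] := by
    intro l
    induction l with
    | nil => rfl
    | cons b l ih => simpa [QueryOrder.mealy] using ih
  have h₂ : ∀ x y : List Bool, QueryOrder.mealy (fun (q : Bool) (o : Option Bool) => q || o.isNone)
      (fun q o => if q then [] else o.toList) (fun _ => []) false (encPair (x, y)) = x := by
    intro x y
    induction x with
    | nil => simpa [QueryOrder.mealy, encPair] using h₁ y
    | cons b x ih => simpa [QueryOrder.mealy, encPair] using ih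
  have h := (PT.self (ea := encPair)).mealy (fun (q : Bool) (o : Option Bool) => q || o.isNone)
      (fun q o => if q then [] else o.toList) (fun _ => []) false
  exact h.congr id (fun _ => rfl) fun p => (h₂ p.1 p.2).symm

theorem PT.snd : PT encPair Prod.snd := by
  have h₁ : ∀ l : List Bool, QueryOrder.mealy (fun (q : Bool) (o : Option Bool) => q || o.isNone)
      (fun q o => if q then o.toList else []) (fun _ => []) true (l.map some) = l := by
    intro l
    induction l with
    | nil => rfl
    | cons b l ih => simpa [QueryOrder.mealy] using ih
  have h₂ : ∀ x y : List Bool, QueryOrder.mealy (fun (q : Bool) (o : Option Bool) => q || o.isNone)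
      (fun q o => if q then o.toList else []) (fun _ => []) false (encPair (x, y)) = y := by
    intro x y
    induction x with
    | nil => simpa [QueryOrder.mealy, encPair] using h₁ y
    | cons b x ih => simpa [QueryOrder.mealy, encPair] using ih
  have h := (PT.self (ea := encPair)).mealy (fun (q : Bool) (o : Option Bool) => q || o.isNone)
      (fun q o => if q then o.toList else []) (fun _ => []) false
  exact h.congr id (fun _ => rfl) fun p => (h₂ p.1 p.2).symm

theorem PT.encPair {α A : Type} [Fintype A] {ea : α → List A} {F G : α → List Bool} (hF : PT ea F)
    (hG : PT ea G) : PT ea fun a => encPair (F a, G a) := by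
  simpa [QueryOrder.encPair] using
    (hF.map some).append ((PT.const (ea := ea) [none]).append (hG.map some))

/-! ### Closure properties of NP -/

/-- The length check moves into the verifier, which can perform it because polynomials can be
evaluated in unary. Closure proofs then deal with a plain existential. -/
theorem mem_NP_iff {L : Lang} : L ∈ NP ↔ ∃ V : List Bool × List Bool → Bool,
    PT encPair (fun p => [V p]) ∧ ∃ p : Polynomial ℕ,
      (∀ x w, V (x, w) = true → w.length ≤ p.eval x.length) ∧
      ∀ x, x ∈ L ↔ ∃ w, V (x, w) = true := by
  constructor
  · rintro ⟨p, V, hV, h⟩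
    have hV' : PT encPair fun p => [V p] := polyTime_iff_PT.mp hV
    refine ⟨fun q => V q && decide (q.2.length ≤ p.eval q.1.length),
      hV'.bool₂ ((PT.fst.unary.eval p).length_le PT.snd) (· && ·), p, ?_, ?_⟩
    · intro x w hw
      simpa using (Bool.and_eq_true_iff.mp hw).2
    · intro x
      simp [h, and_comm]
  · rintro ⟨V, hV, p, hp, h⟩
    refine ⟨p, V, polyTime_iff_PT.mpr hV, fun x => ?_⟩
    rw [h]
    exact exists_congr fun w => ⟨fun hw => ⟨hp x w hw, hw⟩, fun hw => hw.2⟩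

theorem NP_union {L L' : Lang} (h : L ∈ NP) (h' : L' ∈ NP) : L ∪ L' ∈ NP := by
  obtain ⟨V, hV, p, hp, h⟩ := mem_NP_iff.mp h
  obtain ⟨V', hV', p', hp', h'⟩ := mem_NP_iff.mp h'
  refine mem_NP_iff.mpr ⟨_, hV.bool₂ hV' (· || ·), p + p', fun x w hw => ?_, fun x => ?_⟩
  · rw [Polynomial.eval_add]
    rcases Bool.or_eq_true_iff.mp hw with hw | hw
    · exact (hp _ _ hw).trans (Nat.le_add_right _ _)
    · exact (hp' _ _ hw).trans (Nat.le_add_left _ _)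
  · simp [h, h', exists_or]

/-- The subsequence of the bits at the odd positions which are preceded by the tag `t`. -/
def untag (t : Bool) : List Bool → List Bool :=
  mealy (fun (q : Option Bool) b => q.elim (some b) fun _ => none)
    (fun q b => q.elim [] fun t' => if t' = t then [b] else []) (fun _ => []) none

theorem untag_append (t t' : Bool) (w w' : List Bool) :
    untag t (w.flatMap (fun b => [t', b]) ++ w') = (if t' = t then w else []) ++ untag t w' := by
  induction w with
  | nil => simp
  | cons b w ih =>
    have : untag t ((b :: w).flatMap (fun b => [t', b]) ++ w') = (if t' = t then [b] else []) ++
        untag t (w.flatMap (fun b => [t', b]) ++ w') := by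
      simp [untag, mealy]
    rw [this, ih]
    split_ifs <;> simp

/-- A common certificate consists of both certificates, each bit preceded by a tag naming its owner;
hence the factor 2 in the length bound. -/
theorem NP_inter {L L' : Lang} (h : L ∈ NP) (h' : L' ∈ NP) : L ∩ L' ∈ NP := by
  obtain ⟨V, hV, p, hp, h⟩ := mem_NP_iff.mp h
  obtain ⟨V', hV', p', hp', h'⟩ := mem_NP_iff.mp h'
  have hu : ∀ t, PT encPair fun q : List Bool × List Bool => encPair (q.1, untag t q.2) :=
    fun t =>
    PT.encPair PT.fst (PT.snd.mealy _ _ _ _)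
  have h₁ : PT encPair fun q => [V (q.1, untag false q.2)] :=
    PT.comp (eb := encPair) (f := fun q : List Bool × List Bool => (q.1, untag false q.2))
      (hu false) hV
  have h₂ : PT encPair fun q => [V' (q.1, untag true q.2)] :=
    PT.comp (eb := encPair) (f := fun q : List Bool × List Bool => (q.1, untag true q.2))
      (hu true) hV'
  refine ⟨2 * (p + p'), fun q : List Bool × List Bool =>
      V (q.1, untag false q.2) && V' (q.1, untag true q.2),
    polyTime_iff_PT.mpr (h₁.bool₂ h₂ (· && ·)), fun x => ?_⟩
  simp only [Set.mem_inter_iff, h, h', Bool.and_eq_true]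
  constructor
  · rintro ⟨⟨w, hw⟩, w', hw'⟩
    refine ⟨w.flatMap (fun b => [false, b]) ++ (w'.flatMap (fun b => [true, b]) ++ []), ?_, ?_, ?_⟩
    · have := hp _ _ hw
      have := hp' _ _ hw'
      simp [List.length_flatMap]
      omega
    · rw [untag_append, untag_append]
      simpa [untag, mealy] using hw
    · rw [untag_append, untag_append]
      simpa [untag, mealy] using hw'
  · rintro ⟨w, -, hw, hw'⟩
    exact ⟨⟨_, hw⟩, _, hw'⟩

theorem NP_preimage {L : Lang} (h : L ∈ NP) {f : List Bool → List Bool} (hf : PT id f) :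
    f ⁻¹' L ∈ NP := by
  obtain ⟨V, hV, p, hp, h⟩ := mem_NP_iff.mp h
  obtain ⟨q, hq⟩ := PolyTime.length_le hf
  have hf' : PT encPair fun q => f q.1 :=
    PT.comp (B := Bool) (β := List Bool) (eb := id) (f := Prod.fst) PT.fst hf
  refine mem_NP_iff.mpr ⟨fun q : List Bool × List Bool => V (f q.1, q.2),
    PT.comp (eb := encPair) (f := fun q : List Bool × List Bool => (f q.1, q.2))
      (hf'.encPair PT.snd) hV,
    p.comp q, fun x w hw => ?_, fun x => h _⟩
  rw [Polynomial.eval_comp]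
  exact (hp _ _ hw).trans (eval_mono p (hq x))

theorem NP_of_PT {h : List Bool → Bool} (hh : PT id fun x => [h x]) : {x | h x = true} ∈ NP := by
  have h' : PT encPair fun q => [h q.1] := PT.comp (eb := id) (f := Prod.fst) PT.fst hh
  exact ⟨0, fun q => h q.1, polyTime_iff_PT.mpr h', fun x =>
    ⟨fun hx => ⟨[], by simp, hx⟩, fun ⟨_, _, hx⟩ => hx⟩⟩

theorem NP_univ : Set.univ ∈ NP := by
  simpa using NP_of_PT (h := fun _ => true) (PT.const (ea := id) [true])

theorem NP_empty : ∅ ∈ NP := by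
  simpa using NP_of_PT (h := fun _ => false) (PT.const (ea := id) [false])

theorem NP_biUnion {P : Type} (F : Finset P) {L : P → Lang} (h : ∀ p ∈ F, L p ∈ NP) :
    {x | ∃ p ∈ F, x ∈ L p} ∈ NP := by
  classical
  induction F using Finset.induction_on with
  | empty => simpa using NP_empty
  | insert p F _ ih =>
    have := NP_union (h p (by simp)) (ih fun q hq => h q (by simp [hq]))
    convert this using 1
    ext x
    simp

end QueryOrder

namespace QueryOrder

/-! ### A normal form for the boolean hierarchy -/

/-- All the superlevel sets of `c` are in NP. -/
def NPCount (c : List Bool → ℕ) : Prop :=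
  ∀ i, {x | i ≤ c x} ∈ NP

/-- If `c` counts for `B`, then `c + 1` on `A` and `0` elsewhere counts for `A \ B`: the parity
flips, and the superlevel sets are intersected with `A`. Conversely, take `A = {x | 1 ≤ c x}` and
the counter `c - 1` for `B`. -/
theorem mem_BH_iff {k : ℕ} (hk : 1 ≤ k) {L : Lang} :
    L ∈ BH k ↔ ∃ c, NPCount c ∧ (∀ x, c x ≤ k) ∧ L = {x | Odd (c x)} := by
  classical
  induction k, hk using Nat.le_induction generalizing L with
  | base =>
    constructor
    · intro h
      replace h : L ∈ NP := h
      refine ⟨fun x => if x ∈ L then 1 else 0, fun i => ?_,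
        fun x => by dsimp only; split_ifs <;> simp, ?_⟩
      · rcases i with _ | _ | i
        · simpa using NP_univ
        · convert h using 1
          ext x; by_cases hx : x ∈ L <;> simp [hx]
        · convert NP_empty using 1
          ext x; by_cases hx : x ∈ L <;> simp [hx]
      · ext x; by_cases hx : x ∈ L <;> simp [hx]
    · rintro ⟨c, hc, hc', rfl⟩
      change _ ∈ NP
      convert hc 1 using 1
      ext x
      have := hc' x
      simp only [Set.mem_ofPred_eq, Nat.odd_iff]
      omega
  | succ k hk ih =>
    obtain ⟨k, rfl⟩ := Nat.exists_eq_add_of_le' hk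
    constructor
    · rintro ⟨A, hA, B, hB, rfl⟩
      obtain ⟨c, hc, hc', rfl⟩ := ih.mp hB
      refine ⟨fun x => if x ∈ A then c x + 1 else 0, fun i => ?_, fun x => ?_, ?_⟩
      · rcases i with _ | i
        · simpa using NP_univ
        · convert NP_inter hA (hc i) using 1
          ext x; by_cases hx : x ∈ A <;> simp [hx]
      · have := hc' x
        dsimp only
        split_ifs <;> omega
      · ext x; by_cases hx : x ∈ A <;> simp [hx, Nat.odd_add_one]
    · rintro ⟨c, hc, hc', rfl⟩
      refine ⟨{x | 1 ≤ c x}, hc 1, {x | Odd (c x - 1)}, ih.mpr ⟨fun x => c x - 1, fun i => ?_,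
        fun x => ?_, rfl⟩, ?_⟩
      · rcases i with _ | i
        · simpa using NP_univ
        · convert hc (i + 1 + 1) using 1
          ext x
          simp only [Set.mem_ofPred_eq]
          omega
      · have := hc' x
        dsimp only
        omega
      · ext x
        simp only [Set.mem_ofPred_eq, Set.mem_sdiff, Nat.odd_iff]
        omega

/-- A superlevel set of `φ ∘ c` is empty or a superlevel set of `c`, at the least `t` with `i ≤ φ
t`. -/
theorem NPCount.monotone_comp {c : List Bool → ℕ} (hc : NPCount c) {φ : ℕ → ℕ} (hφ : Monotone φ) :
    NPCount fun x => φ (c x) := by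
  classical
  intro i
  by_cases h : ∃ t, i ≤ φ t
  · convert hc (Nat.find h) using 1
    ext x
    exact ⟨fun hx => Nat.find_min' h hx, fun hx => (Nat.find_spec h).trans (hφ hx)⟩
  · convert NP_empty using 1
    ext x
    simp only [Set.mem_ofPred_eq, Set.mem_empty_iff_false, iff_false]
    exact fun hx => h ⟨_, hx⟩

theorem NPCount.preimage {c : List Bool → ℕ} (hc : NPCount c) {f : List Bool → List Bool}
    (hf : PT id f) : NPCount fun x => c (f x) := fun i => NP_preimage (hc i) hf

theorem NPCount.const (n : ℕ) : NPCount fun _ => n := fun i => by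
  by_cases h : i ≤ n
  · simpa [h] using NP_univ
  · simpa [h] using NP_empty

theorem NPCount.ite {c d : List Bool → ℕ} (hc : NPCount c) (hd : NPCount d) {h : List Bool → Bool}
    (hh : PT id fun x => [h x]) : NPCount fun x => if h x then c x else d x := fun i => by
  have hh' : PT id fun x => [!h x] := hh.bool₂ hh fun a _ => !a
  convert NP_union (NP_inter (NP_of_PT hh) (hc i)) (NP_inter (NP_of_PT hh') (hd i)) using 1
  ext x
  cases hx : h x <;> simp [hx]

/-! ### Counting mind changes -/

section MindChanges

variable {P : Type} (le : P → P → Prop) (g : P → Prop)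

/-- Below `p` there is an alternating chain of length `i`. -/
def Alt : ℕ → P → Prop
  | 0, _ => True
  | i + 1, p => ∃ q, le q p ∧ Alt i q ∧ (g q ↔ Odd (i + 1))

variable {le g}

theorem Alt.mono (htrans : ∀ p q r, le p q → le q r → le p r) {i : ℕ} {p p' : P}
    (h : Alt le g i p) (hp : le p p') : Alt le g i p' := by
  cases i with
  | zero => trivial
  | succ i =>
    obtain ⟨q, h₁, h₂⟩ := h
    exact ⟨q, htrans _ _ _ h₁ hp, h₂⟩

theorem Alt.of_succ (htrans : ∀ p q r, le p q → le q r → le p r) {i : ℕ} {p : P}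
    (h : Alt le g (i + 1) p) : Alt le g i p := by
  obtain ⟨q, h₁, h₂, -⟩ := h
  exact h₂.mono htrans h₁

theorem Alt.of_le (htrans : ∀ p q r, le p q → le q r → le p r) {i j : ℕ} (hij : i ≤ j) {p : P}
    (h : Alt le g j p) : Alt le g i p := by
  induction hij with
  | refl => exact h
  | step _ ih => exact ih (h.of_succ htrans)

/-- Consecutive members of the chain disagree about `g`, so `r` rises at each link; the lowest
member satisfies `g` and has rank at least 1. -/
theorem Alt.exists_le_rank {r : P → ℕ} (h₀ : ∀ p, g p → 0 < r p)
    (hr : ∀ q p, le q p → ¬(g q ↔ g p) → r q < r p) {i : ℕ} {p : P} (h : Alt le g (i + 1) p) :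
    ∃ q, le q p ∧ (g q ↔ Odd (i + 1)) ∧ i + 1 ≤ r q := by
  induction i generalizing p with
  | zero =>
    obtain ⟨q, h₁, -, h₂⟩ := h
    exact ⟨q, h₁, h₂, h₀ q (h₂.mpr (by simp))⟩
  | succ i ih =>
    obtain ⟨q, h₁, h₂, h₃⟩ := h
    obtain ⟨q', h₁', h₂', h₃'⟩ := ih h₂
    refine ⟨q, h₁, h₃, ?_⟩
    have := hr q' q h₁' (by rw [h₂', h₃, Nat.odd_add_one (n := i + 1)]; tauto)
    omega

/-- The counter is the maximal length of an alternating chain below `pos x`. Its superlevel sets are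
in NP because a chain exists iff `pos x` lies above one of the finitely many `p ∈ F` that have such
a chain below them. At the maximal length `i`, `g (pos x)` must agree with the parity of `i`, since
otherwise `pos x` itself would prolong the chain. The bound `hrm` concerns only elements that could
be the top of a chain of length `m + 1`; this is where a change can be saved. -/
theorem mem_BH_of_mindChanges (hrefl : ∀ p, le p p)
    (htrans : ∀ p q r, le p q → le q r → le p r) (F : Finset P) (pos : List Bool → P)
    (hpos : ∀ x, pos x ∈ F) (hNP : ∀ p ∈ F, {x | le p (pos x)} ∈ NP) {r : P → ℕ}
    (h₀ : ∀ p, g p → 0 < r p) (hr : ∀ q p, le q p → ¬(g q ↔ g p) → r q < r p) {m : ℕ} (hm : 1 ≤ m)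
    (hrm : ∀ x q, le q (pos x) → (g q ↔ Odd (m + 1)) → r q ≤ m) :
    {x | g (pos x)} ∈ BH m := by
  classical
  have hAlt : ∀ i, {x | Alt le g i (pos x)} ∈ NP := by
    intro i
    convert NP_biUnion (F.filter fun p => Alt le g i p) (L := fun p => {x | le p (pos x)})
      (fun p hp => hNP p (Finset.mem_filter.mp hp).1) using 1
    ext x
    constructor
    · exact fun hx => ⟨pos x, Finset.mem_filter.mpr ⟨hpos x, hx⟩, hrefl _⟩
    · rintro ⟨p, hp, hpx⟩
      exact (Finset.mem_filter.mp hp).2.mono htrans hpx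
  have hbound : ∀ x, ¬ Alt le g (m + 1) (pos x) := by
    intro x hx
    obtain ⟨q, h₁, h₂, h₃⟩ := hx.exists_le_rank h₀ hr
    have := hrm x q h₁ h₂
    omega
  refine (mem_BH_iff hm).mpr ⟨fun x => Nat.findGreatest (fun i => Alt le g i (pos x)) m,
    fun i => ?_, fun x => Nat.findGreatest_le _, ?_⟩
  · by_cases hi : i ≤ m
    · convert hAlt i using 1
      ext x
      constructor
      · intro hx
        exact (Nat.findGreatest_spec (P := fun i => Alt le g i (pos x)) (Nat.zero_le m)
          trivial).of_le htrans hx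
      · exact fun hx => Nat.le_findGreatest hi hx
    · convert NP_empty using 1
      ext x
      simp only [Set.mem_ofPred_eq, Set.mem_empty_iff_false, iff_false]
      exact fun hx => hi (hx.trans (Nat.findGreatest_le _))
  · ext x
    simp only [Set.mem_ofPred_eq]
    set i := Nat.findGreatest (fun i => Alt le g i (pos x)) m with hi
    have h₁ : Alt le g i (pos x) :=
      Nat.findGreatest_spec (P := fun i => Alt le g i (pos x)) (Nat.zero_le m) trivial
    have h₂ : ¬ Alt le g (i + 1) (pos x) := by
      by_cases him : i + 1 ≤ m
      · exact Nat.findGreatest_is_greatest (P := fun i => Alt le g i (pos x)) (n := m)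
          (Nat.lt_succ_self _) him
      · have : i = m := le_antisymm (Nat.findGreatest_le _) (by omega)
        rw [this]
        exact hbound x
    by_contra h
    exact h₂ ⟨pos x, hrefl _, h₁, by rw [Nat.odd_add_one]; tauto⟩

end MindChanges

/-! ### Mind changes of two successive queries -/

/-- The parity of a number, as a boolean. -/
def odd (n : ℕ) : Bool := decide (Odd n)

/-- The languages given by two successive queries to languages from the boolean hierarchy, up to a
polynomial-time correction. -/
theorem mem_BH_of_two_queries {j k m : ℕ} (hk : 1 ≤ k) (hm : 1 ≤ m)
    {a : List Bool → ℕ} {b : Bool → List Bool → ℕ} {acc : Bool → Bool → List Bool → Bool}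
    (ha : NPCount a) (haj : ∀ x, a x ≤ j) (hb : ∀ t, NPCount (b t)) (hbk : ∀ t x, b t x ≤ k)
    (hacc : ∀ s t, PT id fun x => [acc s t x])
    (hjkm : j + 2 * k ≤ m ∨ m + 1 = j + 2 * k ∧
      ∀ x, acc false true x ≠ acc false false x →
        (acc (odd j) (odd k) x ≠ acc false false x ↔ Odd m)) :
    {x | acc (odd (a x)) (odd (b (odd (a x)) x)) x ≠ acc false false x} ∈ BH m := by
  -- A position is the verdict table together with the three counters. The table is known in
  -- polynomial time, so `le` may require equality there; the counters are only known from below.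
  let P : Type := (Bool → Bool → Bool) × ℕ × ℕ × ℕ
  let le : P → P → Prop := fun p q => p.1 = q.1 ∧ p.2.1 ≤ q.2.1 ∧ p.2.2.1 ≤ q.2.2.1 ∧
    p.2.2.2 ≤ q.2.2.2
  let g : P → Prop := fun p =>
    p.1 (odd p.2.1) (odd (if odd p.2.1 then p.2.2.2 else p.2.2.1)) ≠ p.1 false false
  -- If the second answer is irrelevant after a first answer "no", the counter for that case never
  -- influences the verdict and is left out, so that it cannot count as a change.
  let r : P → ℕ := fun p =>
    p.2.1 + (if p.1 false true = p.1 false false then 0 else p.2.2.1) + p.2.2.2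
  let pos : List Bool → P := fun x => (fun s t => acc s t x, a x, b false x, b true x)
  have key := mem_BH_of_mindChanges (le := le) (g := g) (r := r) (m := m)
    (fun p => ⟨rfl, le_rfl, le_rfl, le_rfl⟩)
    (fun _ _ _ h h' => ⟨h.1.trans h'.1, h.2.1.trans h'.2.1, h.2.2.1.trans h'.2.2.1,
      h.2.2.2.trans h'.2.2.2⟩)
    (Finset.univ ×ˢ Finset.range (j + 1) ×ˢ Finset.range (k + 1) ×ˢ Finset.range (k + 1)) pos
    (fun x => Finset.mem_product.mpr ⟨Finset.mem_univ _, Finset.mem_product.mpr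
      ⟨Finset.mem_range_succ_iff.mpr (haj x), Finset.mem_product.mpr
        ⟨Finset.mem_range_succ_iff.mpr (hbk _ x), Finset.mem_range_succ_iff.mpr (hbk _ x)⟩⟩⟩)
    (fun p _ => ?_) (fun p => ?_) (fun q p => ?_) hm (fun x q => ?_)
  · convert key using 1
    ext x
    simp only [Set.mem_ofPred_eq, g, pos]
    cases odd (a x) <;> rfl
  · have h₁ : ∀ s t, {x | acc s t x = p.1 s t} ∈ NP := fun s t => by
      have : PT id fun x => [acc s t x == p.1 s t] :=
        (hacc s t).bool₂ (hacc s t) fun u _ => u == p.1 s t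
      simpa using NP_of_PT this
    convert NP_inter (NP_inter (NP_inter (h₁ false false) (h₁ false true))
      (NP_inter (h₁ true false) (h₁ true true)))
      (NP_inter (ha p.2.1) (NP_inter (hb false p.2.2.1) (hb true p.2.2.2))) using 1
    ext x
    simp only [le, pos, Set.mem_ofPred_eq, Set.mem_inter_iff, funext_iff, Bool.forall_bool]
    tauto
  · simp only [g, r]
    intro h
    by_contra hr
    have h1 : p.2.1 = 0 := by omega
    have h3 : p.2.2.2 = 0 := by omega
    have h2 : (if p.1 false true = p.1 false false then 0 else p.2.2.1) = 0 := by omega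
    simp only [h1, odd] at h
    split_ifs at h2 with h4
    · simp only [Nat.not_odd_zero, decide_false, Bool.false_eq_true, if_false] at h
      cases h5 : decide (Odd p.2.2.1) <;> simp_all
    · simp [h2] at h
  · rintro ⟨h1, h2, h3, h4⟩
    simp only [g, r]
    rw [h1]
    contrapose!
    intro hr
    have h5 : q.2.1 = p.2.1 := by split_ifs at hr <;> omega
    have h6 : q.2.2.2 = p.2.2.2 := by split_ifs at hr <;> omega
    rw [h5, h6]
    split_ifs at hr with h7
    · cases h8 : odd p.2.1
      · cases h9 : odd q.2.2.1 <;> cases h10 : odd p.2.2.1 <;> simp [h7, h9, h10]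
      · simp
    · rw [show q.2.2.1 = p.2.2.1 by omega]
  · rintro ⟨h1, h2, h3, h4⟩ hg
    simp only [pos] at h1 h2 h3 h4
    have := haj x
    have := hbk false x
    have := hbk true x
    rcases hjkm with hjkm | ⟨hjkm, htop⟩
    · simp only [r]
      split_ifs <;> omega
    -- A rank above `m` means rank `j + 2 * k`, attained only at the top `(j, k, k)`, where `htop`
    -- contradicts the parity demanded of `q`. If the middle counter is left out, the rank is at
    -- most `j + k ≤ m`.
    · by_contra hr
      simp only [r, not_le] at hr
      split_ifs at hr with h5
      · omega
      · have e1 : q.2.1 = j := by omega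
        have e2 : q.2.2.1 = k := by omega
        have e3 : q.2.2.2 = k := by omega
        simp only [g, e1, e2, e3, ite_self, h1] at hg
        rw [h1] at h5
        have := htop x h5
        rw [Nat.odd_add_one] at hg
        tauto

/-- The number of mind changes of two successive queries, the second of which is decisive. -/
def changes (j k : ℕ) : ℕ := if Odd (j + k) then j + 2 * k - 1 else j + 2 * k

/-- A path through the positions that advances one counter at a time and changes the second answer
at every step. The numbers `u` and `v` are the largest odd and the largest even number up to `k`:
with `φ₀ = u` and `φ₁ ∈ {0, v}`, each step of `φ` is a change. -/
theorem exists_path {j k : ℕ} (hj : 1 ≤ j) (hk : 1 ≤ k) : ∃ φ φ₀ φ₁ : ℕ → ℕ,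
    Monotone φ ∧ Monotone φ₀ ∧ Monotone φ₁ ∧ (∀ c, φ c ≤ j) ∧ (∀ c, φ₀ c ≤ k) ∧ (∀ c, φ₁ c ≤ k) ∧
    ∀ c ≤ changes j k, (Odd c ↔ Odd (if odd (φ c) then φ₁ c else φ₀ c)) := by
  obtain ⟨u, hu, hu'⟩ : ∃ u, u % 2 = 1 ∧ u ≤ k ∧ k ≤ u + 1 := by
    rcases Nat.even_or_odd' k with ⟨i, hi | hi⟩
    · exact ⟨k - 1, by omega, by omega, by omega⟩
    · exact ⟨k, by omega, by omega, by omega⟩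
  obtain ⟨v, hv, hv'⟩ : ∃ v, v % 2 = 0 ∧ v ≤ k ∧ k ≤ v + 1 := by
    rcases Nat.even_or_odd' k with ⟨i, hi | hi⟩
    · exact ⟨k, by omega, by omega, by omega⟩
    · exact ⟨k - 1, by omega, by omega, by omega⟩
  rcases Nat.mod_two_eq_zero_or_one j with hj' | hj'
  -- For even `j`: `φ₀` rises to `u`, `φ` to 1, `φ₁` to `v`, `φ` on to `j`, and finally `φ₀` from
  -- `u` to `k`. The length is `j + k + v`.
  · refine ⟨fun c => min (c - u) 1 + min (c - u - 1 - v) (j - 1),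
      fun c => min c u + min (c - u - j - v) (k - u), fun c => min (c - u - 1) v,
      fun c d h => ?_, fun c d h => ?_, fun c d h => ?_, fun c => ?_, fun c => ?_, fun c => ?_,
      fun c hc => ?_⟩
    iterate 6 (dsimp only; omega)
    simp only [changes, odd, Nat.odd_iff, decide_eq_true_eq] at *
    split_ifs at * <;> omega
  -- For odd `j`: `φ₀` rises to `u`, `φ` to `j`, then `φ₁` to `k`. The length is `u + j + k`.
  · refine ⟨fun c => min (c - u) j, fun c => min c u, fun c => min (c - u - j) k,
      fun c d h => ?_, fun c d h => ?_, fun c d h => ?_, fun c => ?_, fun c => ?_, fun c => ?_,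
      fun c hc => ?_⟩
    iterate 6 (dsimp only; omega)
    simp only [changes, odd, Nat.odd_iff, decide_eq_true_eq] at *
    split_ifs at * <;> omega

end QueryOrder

namespace QueryOrder

open Turing

namespace OracleTM

variable (M : OracleTM)

/-! ### Runs of oracle machines -/

/-- A configuration, given by its components. -/
def mkCfg (l : Option M.tm.Λ) (v : M.tm.σ) (S : Stk M.tm.Γ) (ans : List Bool) : M.Cfg :=
  ((⟨l, v, S⟩ : TM2.Cfg M.tm.Γ M.tm.Λ M.tm.σ), ans)

/-- The word on the query stack. -/
def word (S : Stk M.tm.Γ) : List Bool :=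
  (S M.tm.k₁).map M.outputAlphabet

theorem init_eq (x : List Bool) : M.init x =
    M.mkCfg (some M.tm.main) M.tm.initialState
      (single M.tm.k₀ (x.map M.inputAlphabet.symm)) [] := by
  rw [← initList_stk]; rfl

theorem step_none (A B : Lang) (v S ans) : M.step A B (M.mkCfg none v S ans) = none := by
  exact (if_neg (nofun : ¬ (none : Option M.tm.Λ) = some M.query)).trans rfl

theorem step_query (A B : Lang) (v S ans) :
    M.step A B (M.mkCfg (some M.query) v S ans) =
      some (M.mkCfg (some (M.answer (chi (if ans = [] then A else B) (M.word S)))) v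
        (Function.update S M.tm.k₁ []) (ans ++ [chi (if ans = [] then A else B) (M.word S)])) := by
  simp only [step, mkCfg, if_true]
  congr

theorem step_of_ne (A B : Lang) {l : M.tm.Λ} (h : l ≠ M.query) (v S ans) :
    M.step A B (M.mkCfg (some l) v S ans) =
      some (M.mkCfg (TM2.stepAux (M.tm.m l) v S).l (TM2.stepAux (M.tm.m l) v S).var
        (TM2.stepAux (M.tm.m l) v S).stk ans) := by
  exact (if_neg (fun e : some l = some M.query => h (Option.some_injective _ e))).trans rfl

variable {M}

theorem iterate_unique {α : Type} {f : α → Option α} {a c c' : α} {n m : ℕ}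
    (h : (flip bind f)^[n] (some a) = some c) (h' : (flip bind f)^[m] (some a) = some c')
    (hc : f c = none) (hc' : f c' = none) : c = c' := by
  wlog hnm : n ≤ m generalizing n m c c'
  · exact (this h' h hc' hc (by omega)).symm
  obtain ⟨d, rfl⟩ := Nat.exists_eq_add_of_le' hnm
  rw [Function.iterate_add_apply, h] at h'
  cases d with
  | zero => exact Option.some_injective _ h'
  | succ d =>
    rw [iterate_bind_succ, hc, iterate_bind_none] at h'
    cases h'

theorem HaltsAt.unique {A B : Lang} {x : List Bool} {c c' : M.Cfg} (h : M.HaltsAt A B x c)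
    (h' : M.HaltsAt A B x c') : c = c' := by
  obtain ⟨t, ⟨⟨⟨n, hn⟩, -⟩⟩, hc⟩ := h
  obtain ⟨t', ⟨⟨⟨n', hn'⟩, -⟩⟩, hc'⟩ := h'
  have step_eq : ∀ c : M.Cfg, c.1.l = none → M.step A B c = none := by
    rintro ⟨⟨l, v, S⟩, ans⟩ rfl
    exact M.step_none A B v S ans
  exact iterate_unique hn hn' (step_eq c hc) (step_eq c' hc')

variable (M) in
/-- The machine, started at the label `l`, up to its next query. -/
noncomputable def untilQuery (l : M.tm.Λ) : Flow M.tm.Γ M.tm.σ :=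
  Flow.ofTM M.tm l fun l => l = M.query

/-- The step that leaves the flowchart at `query` corresponds to the step in which the oracle
answers, so `n₁ + n₂ = n`. Comparing `ans` with `ans'` later tells which alternative holds. -/
theorem reach_untilQuery (A B : Lang) {n : ℕ} {l v S ans v' S' ans'} (l₀ : M.tm.Λ)
    (h : (flip bind (M.step A B))^[n] (some (M.mkCfg (some l) v S ans)) =
      some (M.mkCfg none v' S' ans')) :
    (ans' = ans ∧ (M.untilQuery l₀).Reach l v S n v' S') ∨
    (ans.length < ans'.length ∧ ∃ n₁ n₂ v₁ S₁ b, n₁ + n₂ = n ∧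
      (M.untilQuery l₀).Reach l v S n₁ v₁ S₁ ∧ b = chi (if ans = [] then A else B) (M.word S₁) ∧
      (flip bind (M.step A B))^[n₂] (some (M.mkCfg (some (M.answer b)) v₁
        (Function.update S₁ M.tm.k₁ []) (ans ++ [b]))) = some (M.mkCfg none v' S' ans')) := by
  induction n generalizing l v S ans with
  | zero => cases h
  | succ n ih =>
    rw [iterate_bind_succ] at h
    by_cases hl : l = M.query
    · subst hl
      rw [step_query] at h
      refine .inr ⟨?_, 1, n, v, S, _, by omega, .exit ?_, rfl, h⟩
      · have := ih h
        simp only [List.length_append, List.length_singleton] at this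
        rcases this with ⟨h₁, -⟩ | ⟨h₁, -⟩
        · rw [h₁]; simp
        · omega
      · simp [Flow.next, untilQuery, Flow.ofTM, TM2.stepAux]
    · rw [step_of_ne _ _ _ hl] at h
      have hnext : (M.untilQuery l₀).next l v S =
          ((TM2.stepAux (M.tm.m l) v S).l, (TM2.stepAux (M.tm.m l) v S).var,
            (TM2.stepAux (M.tm.m l) v S).stk) := by
        simp only [Flow.next, untilQuery, Flow.ofTM, if_neg hl, stepAux_ofStmt]
        cases (TM2.stepAux (M.tm.m l) v S).l <;> rfl
      revert h hnext
      generalize TM2.stepAux (M.tm.m l) v S = c₁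
      intro h hnext
      obtain ⟨l₁, v₁, S₁⟩ := c₁
      cases l₁ with
      | none =>
        cases n with
        | zero =>
          cases h
          exact .inl ⟨rfl, .exit hnext⟩
        | succ n =>
          rw [iterate_bind_succ, step_none, iterate_bind_none] at h
          cases h
      | some l₁ =>
        rcases ih h with ⟨h₁, h₂⟩ | ⟨h₁, n₁, n₂, v₂, S₂, b, rfl, h₂, h₃, h₄⟩
        · exact .inl ⟨h₁, .step hnext h₂⟩
        · exact .inr ⟨h₁, n₁ + 1, n₂, v₂, S₂, b, by omega, .step hnext h₂, h₃, h₄⟩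

theorem exists_trace {A B : Lang} {x : List Bool} {c : M.Cfg} {t : ℕ}
    (h : M.HaltsWithin A B x c t) {a b : Bool} (hc : c.2 = [a, b]) :
    ∃ n₁ n₂ n₃ v₁ S₁ v₂ S₂ S₃, n₁ + n₂ + n₃ ≤ t ∧
      (M.untilQuery M.tm.main).Runs M.tm.initialState
        (single M.tm.k₀ (x.map M.inputAlphabet.symm)) n₁ v₁ S₁ ∧
      (M.untilQuery (M.answer a)).Runs v₁ (Function.update S₁ M.tm.k₁ []) n₂ v₂ S₂ ∧
      (M.untilQuery (M.answer b)).Runs v₂ (Function.update S₂ M.tm.k₁ []) n₃ c.1.var S₃ ∧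
      a = chi A (M.word S₁) ∧ b = chi B (M.word S₂) := by
  obtain ⟨⟨⟨⟨n, hn⟩, hnt⟩⟩, hl⟩ := h
  obtain ⟨⟨l, v, S⟩, ans⟩ := c
  dsimp only at hl hc hnt
  subst hl hc
  rw [init_eq] at hn
  change (flip bind (M.step A B))^[n] (some (M.mkCfg (some M.tm.main) M.tm.initialState
    (single M.tm.k₀ (x.map M.inputAlphabet.symm)) [])) = some (M.mkCfg none v S [a, b]) at hn
  rcases reach_untilQuery A B M.tm.main hn with ⟨h, -⟩ | ⟨-, n₁, m, v₁, S₁, a', rfl, h₁, ha, hm⟩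
  · cases h
  rcases reach_untilQuery A B (M.answer a') hm with
    ⟨h, -⟩ | ⟨-, n₂, n₃, v₂, S₂, b', rfl, h₂, hb, hn₃⟩
  · cases h
  rcases reach_untilQuery A B (M.answer b') hn₃ with ⟨h, h₃⟩ | ⟨h, -⟩
  · simp only [List.nil_append, List.cons_append, List.cons.injEq, and_true] at h
    obtain ⟨rfl, rfl⟩ := h
    simp only [List.nil_append, if_true, List.cons_ne_nil, if_false] at ha hb
    exact ⟨n₁, n₂, n₃, v₁, S₁, v₂, S₂, S, by omega, h₁, h₂, h₃, ha, hb⟩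
  · simp at h

end OracleTM

/-! ### From oracle machines to polynomial-time query functions -/

theorem chi_ite (a : Bool) (x : List Bool) : chi (if a then Set.univ else ∅) x = a := by
  cases a <;> simp [chi]

section Stages

variable {K : Type} [DecidableEq K] {Γ : K → Type} {σ : Type}

theorem Flow.Runs.lift_fst {R : Type} {P : Flow Γ σ} {v S n v' S'} (h : P.Runs v S n v' S')
    (r : R) : (Flow.lift (fun k => k) (Part.fst σ R) P).Runs (v, r) S n (v', r) S' := by
  obtain ⟨T, h₁, h₂, -⟩ := Flow.Runs.lift (π := Part.fst σ R) (e := fun k : K => k)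
    (fun _ _ h => h) h (v, r) S rfl (fun _ => rfl)
  obtain rfl : T = S' := funext h₂
  exact h₁

theorem Flow.runs_clear [Fintype K] [Fintype σ] (k : K) (v : σ) (r : Option Unit) (S : Stk Γ) :
    (drain k (fun _ => ()) fun _ _ => []).Runs (v, r) S ((S k).length + 1) (v, none)
      (Function.update S k []) := by
  have h := runs_drain (k := k) (ρ := fun _ => ()) (emit := fun _ _ => []) (by simp) v r S
  have e : (fun k' => ((S k).flatMap fun _ => ([] : List (Γ k'))).reverse ++
      Function.update S k [] k') = Function.update S k [] := by
    funext k'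
    rw [List.flatMap_eq_nil_iff.mpr fun _ _ => rfl]
    rfl
  rwa [e] at h

end Stages

/-- The queries and the verdict of a machine as polynomial-time functions. -/
theorem OracleTM.exists_functions {M : OracleTM} (hM : M.IsPolyTwoQuery) :
    ∃ (q₁ : List Bool → List Bool) (q₂ : Bool → List Bool → List Bool)
      (acc : Bool → Bool → List Bool → Bool),
      PT id q₁ ∧ (∀ a, PT id (q₂ a)) ∧ (∀ a b, PT id fun x => [acc a b x]) ∧
      ∀ (A B : Lang) (x : List Bool), ∃ c, M.HaltsAt A B x c ∧
        c.2 = [chi A (q₁ x), chi B (q₂ (chi A (q₁ x)) x)] ∧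
        M.accept c.1.var = acc (chi A (q₁ x)) (chi B (q₂ (chi A (q₁ x)) x)) x := by
  obtain ⟨p, hp⟩ := hM
  have := M.tm.kFin
  have := M.tm.σFin
  have := M.tm.Γk₀Fin
  -- The time bound and the query pattern hold for all oracles, so constant oracles yield a run for
  -- every pair of hypothetical answers.
  have tr : ∀ (x : List Bool) (a b : Bool), ∃ n₁ n₂ n₃ v₁ S₁ v₂ S₂ v₃ S₃,
      n₁ + n₂ + n₃ ≤ p.eval x.length ∧
      (M.untilQuery M.tm.main).Runs M.tm.initialState
        (single M.tm.k₀ (x.map M.inputAlphabet.symm)) n₁ v₁ S₁ ∧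
      (M.untilQuery (M.answer a)).Runs v₁ (Function.update S₁ M.tm.k₁ []) n₂ v₂ S₂ ∧
      (M.untilQuery (M.answer b)).Runs v₂ (Function.update S₂ M.tm.k₁ []) n₃ v₃ S₃ := by
    intro x a b
    obtain ⟨c, a', b', hc, hc'⟩ := hp (if a then Set.univ else ∅) (if b then Set.univ else ∅) x
    obtain ⟨n₁, n₂, n₃, v₁, S₁, v₂, S₂, S₃, h, h₁, h₂, h₃, ha, hb⟩ := exists_trace hc hc'
    rw [chi_ite] at ha hb
    subst ha hb
    exact ⟨n₁, n₂, n₃, v₁, S₁, v₂, S₂, _, S₃, h, h₁, h₂, h₃⟩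
  choose n₁ n₂ n₃ v₁ S₁ v₂ S₂ v₃ S₃ hn h₁ h₂ h₃ using tr
  -- By determinism the first query does not depend on the answers and the second only on the first
  -- answer; `false` merely fills the irrelevant slots.
  have key : ∀ (A B : Lang) (x : List Bool), ∃ c, M.HaltsAt A B x c ∧
      c.2 = [chi A (M.word (S₁ x false false)),
        chi B (M.word (S₂ x (chi A (M.word (S₁ x false false))) false))] ∧
      M.accept c.1.var = M.accept (v₃ x (chi A (M.word (S₁ x false false)))
        (chi B (M.word (S₂ x (chi A (M.word (S₁ x false false))) false)))) := by
    intro A B x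
    obtain ⟨c, a, b, hc, hc'⟩ := hp A B x
    obtain ⟨m₁, m₂, m₃, w₁, T₁, w₂, T₂, T₃, -, g₁, g₂, g₃, ha, hb⟩ := exists_trace hc hc'
    obtain ⟨e₁, e₂⟩ := g₁.unique (h₁ x false false)
    obtain ⟨e₁', e₂'⟩ := g₁.unique (h₁ x a false)
    obtain ⟨e₁'', e₂''⟩ := g₁.unique (h₁ x a b)
    have g₂' := g₂
    rw [e₁', e₂'] at g₂
    obtain ⟨e₃, e₄⟩ := g₂.unique (h₂ x a false)
    rw [e₁'', e₂''] at g₂'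
    obtain ⟨e₅, e₆⟩ := g₂'.unique (h₂ x a b)
    rw [e₅, e₆] at g₃
    obtain ⟨e₇, -⟩ := g₃.unique (h₃ x a b)
    rw [e₂] at ha
    rw [e₄] at hb
    refine ⟨c, ⟨_, hc⟩, ?_, ?_⟩
    · rw [← ha, ← hb, hc']
    · rw [← ha, ← hb, e₇]
  refine ⟨_, fun a x => M.word (S₂ x a false), fun a b x => M.accept (v₃ x a b), ?_, fun a => ?_,
    fun a b => ?_, key⟩
  · refine polyTime_of_flow (M.untilQuery M.tm.main) M.tm.k₀ M.tm.k₁ M.inputAlphabet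
      M.outputAlphabet M.tm.initialState p fun x =>
      ⟨n₁ x false false, _, _, ?_, h₁ x false false, ?_⟩
    · have := hn x false false
      simp only [id]
      omega
    · simp [word]
  all_goals
    obtain ⟨C, hC⟩ := (M.untilQuery M.tm.main).exists_growth
    obtain ⟨D, hD⟩ := (M.untilQuery (M.answer a)).exists_growth
    have l₁ : ∀ x b, (S₁ x a b M.tm.k₁).length ≤ x.length + C * p.eval x.length := by
      intro x b
      refine (hC _ _ _ _ _ _ (h₁ x a b) _).trans (Nat.add_le_add ?_ ?_)
      · simpa using length_single_le M.tm.k₀ M.tm.k₁ (x.map M.inputAlphabet.symm)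
      · exact Nat.mul_le_mul_left _ (by have := hn x a b; omega)
    -- The answer `a` is hard-wired by restarting at `answer a`, and a drain imitates the erasure of
    -- the query stack.
    let F₂ : Flow M.tm.Γ (M.tm.σ × Option Unit) :=
      ((M.untilQuery M.tm.main).lift (fun k => k) (Part.fst _ _)).seq
        ((Flow.drain M.tm.k₁ (fun _ => ()) fun _ _ => []).seq
          ((M.untilQuery (M.answer a)).lift (fun k => k) (Part.fst _ _)))
    have r₂ : ∀ x b, F₂.Runs (M.tm.initialState, none)
        (single M.tm.k₀ (x.map M.inputAlphabet.symm))
        (n₁ x a b + ((S₁ x a b M.tm.k₁).length + 1 + n₂ x a b)) (v₂ x a b, none) (S₂ x a b) :=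
      fun x b => ((h₁ x a b).lift_fst none).seq
        ((Flow.runs_clear M.tm.k₁ (v₁ x a b) none (S₁ x a b)).seq ((h₂ x a b).lift_fst none))
  · refine polyTime_of_flow F₂ M.tm.k₀ M.tm.k₁ M.inputAlphabet M.outputAlphabet
      (M.tm.initialState, none) (p + (Polynomial.X + Polynomial.C C * p + 1)) fun x =>
      ⟨_, _, _, ?_, r₂ x false, ?_⟩
    · have := hn x a false
      have := l₁ x false
      simp only [Polynomial.eval_add, Polynomial.eval_mul, Polynomial.eval_C, Polynomial.eval_X,
        Polynomial.eval_one, id]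
      omega
    · simp [word]
  · have l₂ : ∀ x, (S₂ x a b M.tm.k₁).length ≤
        x.length + C * p.eval x.length + D * p.eval x.length := by
      intro x
      refine (hD _ _ _ _ _ _ (h₂ x a b) _).trans (Nat.add_le_add ?_ ?_)
      · simp
      · exact Nat.mul_le_mul_left _ (by have := hn x a b; omega)
    let F₃ : Flow M.tm.Γ (M.tm.σ × Option Unit) :=
      F₂.seq ((Flow.drain M.tm.k₁ (fun _ => ()) fun _ _ => []).seq
          ((M.untilQuery (M.answer b)).lift (fun k => k) (Part.fst _ _)))
    have r₃ : ∀ x, F₃.Runs _ _ _ (v₃ x a b, none) (S₃ x a b) :=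
      fun x => (r₂ x b).seq
        ((Flow.runs_clear M.tm.k₁ (v₂ x a b) none (S₂ x a b)).seq ((h₃ x a b).lift_fst none))
    -- An additional stack `none` receives the verdict.
    let Γ : Option M.tm.K → Type := fun k => k.elim Bool M.tm.Γ
    have : Fintype (Γ (some M.tm.k₀)) := M.tm.Γk₀Fin
    let F₄ : Flow Γ ((M.tm.σ × Option Unit) × Unit) :=
      (Flow.lift (Γ := Γ) some (Part.fst _ _) F₃).seq
        (Flow.again (.push none (fun v => M.accept v.1.1) (.goto fun _ => false)))
    refine polyTime_of_flow (Γ := Γ) F₄ (some M.tm.k₀) none M.inputAlphabet (Equiv.refl Bool)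
      ((M.tm.initialState, none), ())
      (p + (Polynomial.X + Polynomial.C C * p + 1) +
        (Polynomial.X + Polynomial.C C * p + Polynomial.C D * p + 1) + 1) fun x => ?_
    obtain ⟨T, r₄, -, hT⟩ := Flow.Runs.lift (Γ := Γ) (π := Part.fst (M.tm.σ × Option Unit) Unit)
      (Option.some_injective _) (r₃ x) ((M.tm.initialState, none), ())
      (single (some M.tm.k₀) (x.map M.inputAlphabet.symm)) rfl
      (single_apply_of_injective (Option.some_injective _) _ · _)
    have hT' : T none = [] := (hT _ (by simp)).trans (single_of_ne (by simp) _)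
    refine ⟨_, _, _, ?_, r₄.seq (Flow.Runs.again_exit (by simp only [TM2.stepAux]; rfl)),
      (Function.update_self _ _ _).trans ?_⟩
    · have := hn x a b
      have := l₁ x b
      have := l₂ x
      simp only [Polynomial.eval_add, Polynomial.eval_mul, Polynomial.eval_C, Polynomial.eval_X,
        Polynomial.eval_one, id]
      omega
    · rw [hT']; rfl

end QueryOrder

/-! ### Oracle machines assembled from flowcharts -/

namespace QueryOrder

open Turing

theorem Flow.Reach.simulate {K : Type} [DecidableEq K] {Γ : K → Type} {σ α : Type} {P : Flow Γ σ}
    {f : α → Option α} (cfg : Option P.Λ → σ → Stk Γ → α)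
    (hf : ∀ l v S, f (cfg (some l) v S) =
      some (cfg (P.next l v S).1 (P.next l v S).2.1 (P.next l v S).2.2))
    {l v S n v' S'} (h : P.Reach l v S n v' S') :
    (flip bind f)^[n] (some (cfg (some l) v S)) = some (cfg none v' S') := by
  induction h with
  | exit h => rw [iterate_bind_succ, hf, h]; rfl
  | step h _ ih => rw [iterate_bind_succ, hf, h]; exact ih

theorem iterate_bind_trans {α : Type} {f : α → Option α} {a b c : α} {m n : ℕ}
    (h : (flip bind f)^[m] (some a) = some b) (h' : (flip bind f)^[n] (some b) = some c) :
    (flip bind f)^[n + m] (some a) = some c := by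
  rw [Function.iterate_add_apply, h, h']

theorem iterate_bind_one {α : Type} {f : α → Option α} {a b : α} (h : f a = some b) :
    (flip bind f)^[1] (some a) = some b := h

namespace OracleTM

theorem stepAux_branch_record {K : Type} [DecidableEq K] {Γ : K → Type} {σ Λ : Type}
    (first : σ → Bool) (r : σ → σ) (l : Λ) (v : σ) (S : Stk Γ) :
    TM2.stepAux (.branch first (.load r (.goto fun _ => l)) (.load r .halt)) v S =
      ⟨bif first v then some l else none, r v, S⟩ := by
  cases h : first v <;> simp [TM2.stepAux, h]

section OfFlows

variable {K : Type} [DecidableEq K] [Fintype K] {Γ : K → Type} {σ : Type} [Fintype σ]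

/-- The oracle machine which runs `P₀`, asks its first query, runs `P₁`, and asks its second query.
Answers are recorded in the state, where `first` tells which answer is awaited. -/
def ofFlows (P₀ P₁ : Flow Γ σ) (k₀ k₁ : K) [Fintype (Γ k₀)] (i₀ : Γ k₀ ≃ Bool) (i₁ : Γ k₁ ≃ Bool)
    (v₀ : σ) (first : σ → Bool) (record : Bool → σ → σ) (accept : σ → Bool) : OracleTM where
  tm :=
    { K := K
      k₀ := k₀
      k₁ := k₁
      Γ := Γ
      Λ := (P₀.Λ ⊕ P₁.Λ) ⊕ Option Bool
      main := .inl (.inl P₀.entry)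
      σ := σ
      initialState := v₀
      m := fun l => match l with
        | .inl (.inl l) => toStmt (fun o => some (o.elim (.inr none) fun l => .inl (.inl l)))
            (.inr none) (P₀.code l)
        | .inl (.inr l) => toStmt (fun o => some (o.elim (.inr none) fun l => .inl (.inr l)))
            (.inr none) (P₁.code l)
        | .inr none => .halt
        | .inr (some b) => .branch first (.load (record b) (.goto fun _ => .inl (.inr P₁.entry)))
            (.load (record b) .halt) }
  inputAlphabet := i₀
  outputAlphabet := i₁
  query := .inr none
  answer b := .inr (some b)
  accept := accept

theorem haltsWithin_ofFlows {P₀ P₁ : Flow Γ σ} {k₀ k₁ : K} [Fintype (Γ k₀)] {i₀ : Γ k₀ ≃ Bool}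
    {i₁ : Γ k₁ ≃ Bool} {v₀ : σ} {first : σ → Bool} {record : Bool → σ → σ} {accept : σ → Bool}
    {A B : Lang} {x : List Bool} {n₀ n₁ : ℕ} {v₁ v₂ : σ} {S₁ S₂ : Stk Γ} {a b : Bool}
    (h₀ : P₀.Runs v₀ (single k₀ (x.map i₀.symm)) n₀ v₁ S₁) (f₁ : first v₁ = true)
    (ha : a = chi A ((S₁ k₁).map i₁))
    (h₁ : P₁.Runs (record a v₁) (Function.update S₁ k₁ []) n₁ v₂ S₂) (f₂ : first v₂ = false)
    (hb : b = chi B ((S₂ k₁).map i₁)) :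
    ∃ c, (ofFlows P₀ P₁ k₀ k₁ i₀ i₁ v₀ first record accept).HaltsWithin A B x c
      (n₀ + n₁ + 4) ∧ c.2 = [a, b] ∧
      (ofFlows P₀ P₁ k₀ k₁ i₀ i₁ v₀ first record accept).accept c.1.var = accept (record b v₂) := by
  set M := ofFlows P₀ P₁ k₀ k₁ i₀ i₁ v₀ first record accept with hM
  have run₀ : ∀ {v S n v' S'} (ans : List Bool), P₀.Runs v S n v' S' →
      (flip bind (M.step A B))^[n] (some (M.mkCfg (some (.inl (.inl P₀.entry))) v S ans)) =
        some (M.mkCfg (some M.query) v' S' ans) := fun ans h =>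
    Flow.Reach.simulate (fun o v S => M.mkCfg (some (o.elim (.inr none) fun l => .inl (.inl l)))
      v S ans) (fun l v S => (M.step_of_ne A B (l := .inl (.inl l)) nofun v S ans).trans
        (congrArg (fun c : TM2.Cfg Γ ((P₀.Λ ⊕ P₁.Λ) ⊕ Option Bool) σ =>
          some (M.mkCfg c.l c.var c.stk ans)) (stepAux_toStmt _ _ (P₀.code l) v S))) h
  have run₁ : ∀ {v S n v' S'} (ans : List Bool), P₁.Runs v S n v' S' →
      (flip bind (M.step A B))^[n] (some (M.mkCfg (some (.inl (.inr P₁.entry))) v S ans)) =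
        some (M.mkCfg (some M.query) v' S' ans) := fun ans h =>
    Flow.Reach.simulate (fun o v S => M.mkCfg (some (o.elim (.inr none) fun l => .inl (.inr l)))
      v S ans) (fun l v S => (M.step_of_ne A B (l := .inl (.inr l)) nofun v S ans).trans
        (congrArg (fun c : TM2.Cfg Γ ((P₀.Λ ⊕ P₁.Λ) ⊕ Option Bool) σ =>
          some (M.mkCfg c.l c.var c.stk ans)) (stepAux_toStmt _ _ (P₁.code l) v S))) h
  have answered : ∀ (b : Bool) (v : σ) (S : Stk Γ) (ans : List Bool),
      M.step A B (M.mkCfg (some (M.answer b)) v S ans) =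
        some (M.mkCfg (bif first v then some (.inl (.inr P₁.entry)) else none) (record b v) S
          ans) := by
    intro b v S ans
    refine (M.step_of_ne A B (l := .inr (some b)) nofun v S ans).trans ?_
    have e : TM2.stepAux (M.tm.m (.inr (some b))) v S =
        ⟨bif first v then some (.inl (.inr P₁.entry)) else none, record b v, S⟩ := by
      exact stepAux_branch_record first (record b) _ v S
    exact congrArg (fun c : TM2.Cfg Γ ((P₀.Λ ⊕ P₁.Λ) ⊕ Option Bool) σ =>
        some (M.mkCfg c.l c.var c.stk ans)) e
  refine ⟨M.mkCfg none (record b v₂) (Function.update S₂ k₁ []) [a, b], ⟨⟨⟨⟨n₀ + n₁ + 4, ?_⟩,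
    le_rfl⟩⟩, rfl⟩, rfl, rfl⟩
  have q₀ : M.step A B (M.mkCfg (some M.query) v₁ S₁ []) =
      some (M.mkCfg (some (M.answer a)) v₁ (Function.update S₁ k₁ []) [a]) := by
    refine (M.step_query A B v₁ S₁ []).trans ?_
    rw [if_pos rfl]
    rw [ha]
    rfl
  have q₁ : M.step A B (M.mkCfg (some M.query) v₂ S₂ [a]) =
      some (M.mkCfg (some (M.answer b)) v₂ (Function.update S₂ k₁ []) [a, b]) := by
    refine (M.step_query A B v₂ S₂ [a]).trans ?_
    rw [if_neg (by simp)]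
    rw [hb]
    rfl
  have a₀ := answered a v₁ (Function.update S₁ k₁ []) [a]
  have a₁ := answered b v₂ (Function.update S₂ k₁ []) [a, b]
  rw [f₁] at a₀
  rw [f₂] at a₁
  -- The four extra steps are two queries and two recordings of an answer.
  rw [init_eq, show n₀ + n₁ + 4 = 1 + (1 + (n₁ + (1 + (1 + n₀)))) by omega]
  exact iterate_bind_trans (iterate_bind_trans (iterate_bind_trans (iterate_bind_trans
    (iterate_bind_trans (run₀ [] h₀) (iterate_bind_one q₀)) (iterate_bind_one a₀)) (run₁ [a] h₁))
    (iterate_bind_one q₁)) (iterate_bind_one a₁)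

end OfFlows

end OracleTM

end QueryOrder

/-! ### A machine asking two prescribed queries -/

namespace QueryOrder

open Turing

section Distribute

variable {K : Type} [DecidableEq K] [Fintype K] {Γ : K → Type} {τ R : Type} [Fintype τ] [Fintype R]

/-- Empty the stack `k`, writing to three stacks. -/
theorem Flow.runs_split₃ {k t₁ t₂ t₃ : K} (h₁ : k ≠ t₁) (h₂ : k ≠ t₂) (h₃ : k ≠ t₃)
    (h₁₂ : t₁ ≠ t₂) (h₁₃ : t₁ ≠ t₃) (h₂₃ : t₂ ≠ t₃) (ρ : Γ k → R)
    (w₁ : R → List (Γ t₁)) (w₂ : R → List (Γ t₂)) (w₃ : R → List (Γ t₃)) (v : τ) (r : Option R)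
    (S : Stk Γ) :
    ∃ S', (drain k ρ fun r k' =>
          single t₁ (w₁ r) k' ++ single t₂ (w₂ r) k' ++ single t₃ (w₃ r) k').Runs
        (v, r) S ((S k).length + 1) (v, none) S' ∧
      S' t₁ = ((S k).flatMap fun a => w₁ (ρ a)).reverse ++ S t₁ ∧
      S' t₂ = ((S k).flatMap fun a => w₂ (ρ a)).reverse ++ S t₂ ∧
      S' t₃ = ((S k).flatMap fun a => w₃ (ρ a)).reverse ++ S t₃ ∧
      ∀ k', k' ≠ k → k' ≠ t₁ → k' ≠ t₂ → k' ≠ t₃ → S' k' = S k' := by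
  refine ⟨_, runs_drain (fun r => by simp [h₁, h₂, h₃]) v r S, ?_, ?_, ?_,
    fun k' h h' h'' h''' => ?_⟩
  · simp [h₁.symm, h₁₂, h₁₃]
  · simp [h₂.symm, h₁₂.symm, h₂₃]
  · simp [h₃.symm, h₁₃.symm, h₂₃.symm]
  · simp [h, h', h'', h''']

end Distribute

theorem reverse_flatMap_tagged {A : Type} (i : A ≃ Bool ⊕ (Bool ⊕ Bool)) {x y z : List Bool}
    {s : List A}
    (hs : s = (x.map Sum.inl ++ (y.map Sum.inl ++ z.map Sum.inr).map Sum.inr).map i.symm)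
    {l : List Bool} (hl : l = []) :
    (s.flatMap fun a => (i a).elim (fun b => [b]) fun _ => []).reverse ++ l = x.reverse ∧
    (s.flatMap fun a => (i a).elim (fun _ => []) fun r =>
      r.elim (fun b => [b]) fun _ => []).reverse ++ l = y.reverse ∧
    (s.flatMap fun a => (i a).elim (fun _ => []) fun r =>
      r.elim (fun _ => []) fun b => [b]).reverse ++ l = z.reverse := by
  subst hs hl
  have h : ∀ l : List Bool, (l.flatMap fun _ => ([] : List Bool)) = [] := fun l =>
    List.flatMap_eq_nil_iff.mpr fun _ _ => rfl
  simp [List.flatMap_map, h]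

theorem length_map_tagged {A B C D : Type} (f : B ⊕ (C ⊕ D) → A) (x : List B) (y : List C)
    (z : List D) : ((x.map Sum.inl ++ (y.map Sum.inl ++ z.map Sum.inr).map Sum.inr).map f).length =
      x.length + (y.length + z.length) := by
  simp

/-- On input `x`, ask `x`, then ask the first answer followed by `x`, and add `h x` to the second
answer. -/
theorem OracleTM.exists_twoQuery {h : List Bool → Bool} (hh : PT id fun x => [h x]) :
    ∃ M : OracleTM, M.IsPolyTwoQuery ∧ ∀ A B x c, M.HaltsAt A B x c →
      c.2 = [chi A x, chi B (chi A x :: x)] ∧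
      M.accept c.1.var = xor (h x) (chi B (chi A x :: x)) := by
  -- One subroutine delivers `h x` and two copies of `x`, one for each query, since the query stack
  -- is erased.
  obtain ⟨tm, i₀, i₁, p, hp⟩ := (hh.pair (PT.self.pair PT.self)).exists_flow
  have := tm.kFin
  have := tm.σFin
  let K : Type := tm.K ⊕ Fin 4
  let Γ : K → Type := Sum.elim tm.Γ fun _ => Bool
  let R : Type := Bool ⊕ (Bool ⊕ Bool)
  -- The three added components hold `h x`, the first answer (`none` while it is awaited) and the
  -- latest answer.
  let σ : Type := (tm.σ × (Bool × Option Bool × Bool)) × Option R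
  let e : tm.K → K := Sum.inl
  let t : Fin 4 → K := Sum.inr
  let π : Part σ tm.σ := (Part.fst _ _).comp (Part.fst _ _)
  have he : e.Injective := Sum.inl_injective
  have ht : ∀ {m n}, m ≠ n → t m ≠ t n := fun h h' => h (Sum.inr_injective h')
  have het : ∀ k n, e k ≠ t n := nofun
  let P₀ : Flow Γ σ := (Flow.lift e π (Flow.ofTM tm tm.main fun _ => False)).seq
    ((Flow.drain (e tm.k₁) (fun a : tm.Γ tm.k₁ => i₁ a) fun r k' =>
      single (t 0) (r.elim (fun b => [b]) fun _ => []) k' ++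
        single (t 1) (r.elim (fun _ => []) fun r => r.elim (fun b => [b]) fun _ => []) k' ++
        single (t 2) (r.elim (fun _ => []) fun r => r.elim (fun _ => []) fun b => [b]) k').seq
    ((Flow.drain (t 1) (fun b : Bool => Sum.inl b) fun r =>
      single (t 3) (r.elim (fun b => [b]) fun _ => [])).seq
      (Flow.again (.pop (t 0)
        (fun v (o : Option Bool) => ((v.1.1, o.getD false, v.1.2.2), v.2))
        (.goto fun _ => false)))))
  let P₁ : Flow Γ σ :=
    (Flow.drain (t 2) (fun b : Bool => Sum.inl b) fun r =>
      single (t 3) (r.elim (fun b => [b]) fun _ => [])).seq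
      (Flow.again (.push (t 3) (fun v => v.1.2.2.1.getD false) (.goto fun _ => false)))
  have : Fintype (Γ (e tm.k₀)) := tm.Γk₀Fin
  let M : OracleTM := .ofFlows P₀ P₁ (e tm.k₀) (t 3) i₀ (Equiv.refl Bool)
    ((tm.initialState, false, none, false), none) (fun v => v.1.2.2.1.isNone)
    (fun b v => ((v.1.1, v.1.2.1, some (v.1.2.2.1.getD b), b), v.2))
    (fun v => xor v.1.2.1 v.1.2.2.2)
  obtain ⟨q, run⟩ : ∃ q : Polynomial ℕ, ∀ A B x, ∃ c, M.HaltsWithin A B x c (q.eval x.length) ∧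
      c.2 = [chi A x, chi B (chi A x :: x)] ∧
      M.accept c.1.var = xor (h x) (chi B (chi A x :: x)) := by
    refine ⟨p + (2 * Polynomial.X + 2) + (Polynomial.X + 1) + 1 + (Polynomial.X + 1 + 1) + 4,
      fun A B x => ?_⟩
    obtain ⟨n, hn, hr⟩ := hp x
    let S₀ : Stk Γ := single (e tm.k₀) (x.map i₀.symm)
    obtain ⟨S₁, r₁, hS₁, hS₁'⟩ := Flow.Runs.subroutine (Γ := Γ) he π hr
      (v := ((tm.initialState, false, none, false), none)) (S := S₀) rfl (single_self _ _)
      (fun k hk => single_of_ne (fun h => hk (he h)) _)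
    have hS₁t : ∀ n, S₁ (t n) = [] := fun n =>
      (hS₁' _ fun _ => het _ _).trans (single_of_ne (het _ _).symm _)
    obtain ⟨S₂, r₂, h₂₀, h₂₁, h₂₂, hS₂⟩ := Flow.runs_split₃ (Γ := Γ) (R := R)
      (τ := tm.σ × (Bool × Option Bool × Bool)) (het tm.k₁ 0) (het tm.k₁ 1)
      (het tm.k₁ 2) (ht (by decide)) (ht (by decide)) (ht (by decide))
      (fun a : tm.Γ tm.k₁ => i₁ a) (fun r => r.elim (fun b => [b]) fun _ => [])
      (fun r => r.elim (fun _ => []) fun r => r.elim (fun b => [b]) fun _ => [])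
      (fun r => r.elim (fun _ => []) fun r => r.elim (fun _ => []) fun b => [b])
      (tm.initialState, false, none, false) none S₁
    replace h₂₀ : S₂ (t 0) = [h x] :=
      h₂₀.trans (reverse_flatMap_tagged i₁ hS₁ (hS₁t 0)).1
    replace h₂₁ : S₂ (t 1) = x.reverse :=
      h₂₁.trans (reverse_flatMap_tagged i₁ hS₁ (hS₁t 1)).2.1
    replace h₂₂ : S₂ (t 2) = x.reverse :=
      h₂₂.trans (reverse_flatMap_tagged i₁ hS₁ (hS₁t 2)).2.2
    have h₂₃ : S₂ (t 3) = [] := (hS₂ _ (het _ _).symm (ht (by decide)) (ht (by decide))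
      (ht (by decide))).trans (hS₁t 3)
    obtain ⟨S₃, r₃, h₃₃, -, hS₃⟩ := Flow.runs_move (Γ := Γ) (R := R)
      (τ := tm.σ × (Bool × Option Bool × Bool)) (k := t 1) (t := t 3) (ht (by decide))
      (fun b : Bool => Sum.inl b) (fun r => r.elim (fun b => [b]) fun _ => []) (fun b => b)
      (fun _ => rfl) (tm.initialState, false, none, false) none S₂
    replace h₃₃ : S₃ (t 3) = x := h₃₃.trans (reverse_map_self_append h₂₁ h₂₃)
    have h₃₀ : S₃ (t 0) = [h x] := (hS₃ _ (ht (by decide)) (ht (by decide))).trans h₂₀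
    have h₃₂ : S₃ (t 2) = x.reverse := (hS₃ _ (ht (by decide)) (ht (by decide))).trans h₂₂
    let S₄ : Stk Γ := Function.update S₃ (t 0) (S₃ (t 0)).tail
    have r₄ : (Flow.again (Γ := Γ) (.pop (t 0)
        (fun (v : σ) (o : Option Bool) => ((v.1.1, o.getD false, v.1.2.2), v.2))
        (.goto fun _ => false))).Runs ((tm.initialState, false, none, false), none) S₃ 1
        ((tm.initialState, h x, none, false), none) S₄ := by
      refine Flow.Runs.again_exit ?_
      exact congrArg (fun l : List Bool => (⟨some false, ((tm.initialState, l.head?.getD false,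
        none, false), none), S₄⟩ : TM2.Cfg Γ Bool σ)) h₃₀
    have h₄₃ : S₄ (t 3) = x := (Function.update_of_ne (ht (by decide)) _ _).trans h₃₃
    have h₄₂ : S₄ (t 2) = x.reverse := (Function.update_of_ne (ht (by decide)) _ _).trans h₃₂
    have ha : chi A x = chi A ((S₄ (t 3)).map (Equiv.refl Bool)) :=
      congrArg _ (h₄₃.symm.trans (List.map_id _).symm)
    let S₅ : Stk Γ := Function.update S₄ (t 3) []
    have h₅₂ : S₅ (t 2) = x.reverse := (Function.update_of_ne (ht (by decide)) _ _).trans h₄₂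
    obtain ⟨S₆, r₆, h₆₃, -, -⟩ := Flow.runs_move (Γ := Γ) (R := R)
      (τ := tm.σ × (Bool × Option Bool × Bool)) (k := t 2) (t := t 3) (ht (by decide))
      (fun b : Bool => Sum.inl b) (fun r => r.elim (fun b => [b]) fun _ => []) (fun b => b)
      (fun _ => rfl) (tm.initialState, h x, some (chi A x), chi A x) none S₅
    replace h₆₃ : S₆ (t 3) = x :=
      h₆₃.trans (reverse_map_self_append h₅₂ (Function.update_self _ _ _))
    let S₇ : Stk Γ := Function.update S₆ (t 3) (chi A x :: S₆ (t 3))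
    have r₇ : (Flow.again (Γ := Γ) (.push (t 3) (fun v : σ => v.1.2.2.1.getD false)
        (.goto fun _ => false))).Runs ((tm.initialState, h x, some (chi A x), chi A x), none) S₆ 1
        ((tm.initialState, h x, some (chi A x), chi A x), none) S₇ := Flow.Runs.again_exit rfl
    have h₇₃ : S₇ (t 3) = chi A x :: x :=
      (Function.update_self _ _ _).trans (congrArg (chi A x :: ·) h₆₃)
    have hb : chi B (chi A x :: x) = chi B ((S₇ (t 3)).map (Equiv.refl Bool)) :=
      congrArg _ (h₇₃.symm.trans (List.map_id _).symm)
    obtain ⟨c, hc, hc', hc''⟩ := haltsWithin_ofFlows (Γ := Γ) (A := A) (B := B)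
      (k₀ := e tm.k₀) (k₁ := t 3) (i₀ := i₀)
      (i₁ := Equiv.refl Bool) (first := fun v : σ => v.1.2.2.1.isNone)
      (record := fun b v => ((v.1.1, v.1.2.1, some (v.1.2.2.1.getD b), b), v.2))
      (accept := fun v => xor v.1.2.1 v.1.2.2.2)
      (r₁.seq (r₂.seq (r₃.seq r₄))) rfl ha (r₆.seq r₇) rfl hb
    refine ⟨c, ⟨⟨⟨hc.1.some.1, hc.1.some.2.trans ?_⟩⟩, hc.2⟩, hc', hc''⟩
    have l₁ : (S₁ (e tm.k₁)).length = 1 + (x.length + x.length) :=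
      (congrArg List.length hS₁).trans
        (length_map_tagged _ [h x] x x)
    have l₂ : (S₂ (t 1)).length = x.length := (congrArg List.length h₂₁).trans List.length_reverse
    have l₃ : (S₅ (t 2)).length = x.length := (congrArg List.length h₅₂).trans List.length_reverse
    rw [l₁, l₂, l₃]
    simp only [Polynomial.eval_add, Polynomial.eval_mul, Polynomial.eval_ofNat, Polynomial.eval_X,
      Polynomial.eval_one, id] at *
    omega
  refine ⟨M, ⟨q, fun A B x => ?_⟩, fun A B x c hc => ?_⟩
  · obtain ⟨c, hc, hc', -⟩ := run A B x
    exact ⟨c, _, _, hc, hc'⟩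
  · obtain ⟨c', hc', h'⟩ := run A B x
    rwa [hc.unique ⟨_, hc'⟩]

end QueryOrder

namespace QueryOrder

/-! ### Query order and the boolean hierarchy -/

theorem mem_R1tt_of_xor {C : Set Lang} {L L' : Lang} (hL' : L' ∈ C) {s : List Bool → Bool}
    (hs : PT id fun x => [s x]) (h : ∀ x, x ∈ L ↔ xor (s x) (chi L' x) = true) : L ∈ R1tt C := by
  refine ⟨L', hL', fun x => (x, fun b => xor (s x) b), ?_, h⟩
  have h₁ : PT id fun x => [!s x] := hs.bool₂ hs fun a _ => !a
  exact polyTime_iff_PT.mpr (by simpa [encTT] using (hs.append h₁).append PT.self)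

theorem mem_language_iff {M : OracleTM} {A B : Lang} {x : List Bool} {c : M.Cfg}
    (hc : M.HaltsAt A B x c) : x ∈ M.language A B ↔ M.accept c.1.var = true :=
  ⟨fun ⟨_, hc', h⟩ => hc'.unique hc ▸ h, fun h => ⟨c, hc, h⟩⟩

theorem chi_odd (c : List Bool → ℕ) (x : List Bool) : chi {x | Odd (c x)} x = odd (c x) := by
  simp [chi, odd]

/-- Here the table is `acc s t = t`, so the verdict at the top is the parity of `k`. For odd `j + k`
this is the wrong parity for a chain of length `j + 2 * k`. -/
theorem PQueryPlus_subset_BH {j k : ℕ} (hj : 1 ≤ j) (hk : 1 ≤ k) :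
    PQueryPlus (BH j) (BH k) ⊆ BH (changes j k) := by
  rintro _ ⟨M, hM, hM', A, hA, B, hB, rfl⟩
  obtain ⟨a, ha, haj, rfl⟩ := (mem_BH_iff hj).mp hA
  obtain ⟨b, hb, hbk, rfl⟩ := (mem_BH_iff hk).mp hB
  obtain ⟨q₁, q₂, acc, h₁, h₂, -, h⟩ := OracleTM.exists_functions hM
  convert mem_BH_of_two_queries (j := j) (k := k) (m := changes j k)
    (a := fun x => a (q₁ x)) (b := fun s x => b (q₂ s x)) (acc := fun _ t _ => t) hk ?_
    (ha.preimage h₁) (fun x => haj _) (fun s => hb.preimage (h₂ s)) (fun s x => hbk _)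
    (fun s t => PT.const [t]) ?_ using 1
  · ext x
    obtain ⟨c, hc, hc', -⟩ := h {x | Odd (a x)} {x | Odd (b x)} x
    rw [mem_language_iff hc, hM' _ _ _ _ hc, hc']
    simp [chi_odd]
  · simp only [changes]
    split_ifs <;> omega
  · simp only [changes]
    split_ifs with hjk
    · refine .inr ⟨by omega, fun x _ => ?_⟩
      simp only [odd, Nat.odd_iff, ne_eq, decide_eq_false_iff_not] at *
      omega
    · exact .inl le_rfl

/-- The number of mind changes of two successive queries, up to a polynomial-time correction. -/
theorem PQuery_subset_R1tt {j k m : ℕ} (hj : 1 ≤ j) (hk : 1 ≤ k)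
    (hm : j + 2 * k ≤ m ∨ m + 1 = j + 2 * k ∧ Even j ∧ Odd k) :
    PQuery (BH j) (BH k) ⊆ R1tt (BH m) := by
  rintro _ ⟨M, hM, A, hA, B, hB, rfl⟩
  obtain ⟨a, ha, haj, rfl⟩ := (mem_BH_iff hj).mp hA
  obtain ⟨b, hb, hbk, rfl⟩ := (mem_BH_iff hk).mp hB
  obtain ⟨q₁, q₂, acc, h₁, h₂, h₃, h⟩ := OracleTM.exists_functions hM
  refine mem_R1tt_of_xor (mem_BH_of_two_queries (j := j) (k := k) (m := m)
    (a := fun x => a (q₁ x)) (b := fun s x => b (q₂ s x)) (acc := acc) hk (by omega)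
    (ha.preimage h₁) (fun x => haj _) (fun s => hb.preimage (h₂ s)) (fun s x => hbk _)
    h₃ ?_) (h₃ false false) fun x => ?_
  · rcases hm with hm | ⟨hm, hj', hk'⟩
    · exact .inl hm
    -- For even `j` and odd `k` the top has the answers (no, yes), where `hx` fixes the verdict. For
    -- odd `j` and even `k` it would be (yes, no), about which `hx` says nothing.
    · refine .inr ⟨hm, fun x hx => ?_⟩
      have e₁ : odd j = false := by simpa [odd] using hj'
      have e₂ : odd k = true := by simpa [odd] using hk'
      rw [e₁, e₂]
      simp only [Nat.odd_iff, Nat.even_iff] at *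
      simp only [hx, true_iff, not_false_eq_true, ne_eq]
      omega
  · obtain ⟨c, hc, -, hc'⟩ := h {x | Odd (a x)} {x | Odd (b x)} x
    rw [mem_language_iff hc, hc']
    simp only [chi_odd]
    cases e : acc false false x <;> simp [chi, e]

/-- Queries to the boolean hierarchy which realize a given number of mind changes. -/
theorem exists_queries {j k : ℕ} (hj : 1 ≤ j) (hk : 1 ≤ k) {c : List Bool → ℕ} (hc : NPCount c)
    (hcm : ∀ x, c x ≤ changes j k) :
    ∃ A ∈ BH j, ∃ B ∈ BH k, ∀ x, chi B (chi A x :: x) = odd (c x) := by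
  obtain ⟨φ, φ₀, φ₁, m, m₀, m₁, b, b₀, b₁, h⟩ := exists_path hj hk
  have ht : PT id fun y : List Bool => y.tail := PT.self.tail
  refine ⟨{x | Odd (φ (c x))}, (mem_BH_iff hj).mpr ⟨_, hc.monotone_comp m, fun x => b _, rfl⟩,
    {y | Odd (if decide (y.head? = some true) then φ₁ (c y.tail) else φ₀ (c y.tail))},
    (mem_BH_iff hk).mpr ⟨_, ((hc.preimage ht).monotone_comp m₁).ite
      ((hc.preimage ht).monotone_comp m₀) (PT.self.head? (some true)), fun y => ?_, rfl⟩,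
    fun x => ?_⟩
  · split_ifs
    exacts [b₁ _, b₀ _]
  · rw [chi_odd, chi_odd fun x => φ (c x)]
    have := h (c x) (hcm x)
    simp only [odd, List.head?_cons, List.tail_cons, Option.some.injEq] at this ⊢
    rw [decide_eq_decide, this]
    simp

theorem BH_subset_PQueryPlus {j k : ℕ} (hj : 1 ≤ j) (hk : 1 ≤ k) :
    BH (changes j k) ⊆ PQueryPlus (BH j) (BH k) := by
  intro L hL
  obtain ⟨c, hc, hcm, rfl⟩ := (mem_BH_iff (by simp only [changes]; split_ifs <;> omega)).mp hL
  obtain ⟨A, hA, B, hB, hAB⟩ := exists_queries hj hk hc hcm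
  obtain ⟨M, hM, h⟩ := OracleTM.exists_twoQuery (h := fun _ => false) (PT.const [false])
  refine ⟨M, hM, fun A B x c hc => ?_, A, hA, B, hB, ?_⟩
  · obtain ⟨h₁, h₂⟩ := h A B x c hc
    rw [h₁, h₂]
    simp
  · ext x
    obtain ⟨p, hp⟩ := hM
    obtain ⟨c', _, _, hc', -⟩ := hp A B x
    rw [mem_language_iff ⟨_, hc'⟩, (h A B x c' ⟨_, hc'⟩).2, hAB]
    simp [odd]

/-- A unary predicate is its value at `false`, plus the argument if it is not constant. The machine
adds the former as its correction, and constant predicates are absorbed by setting the counter to 0.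
-/
theorem R1tt_subset_PQuery {j k : ℕ} (hj : 1 ≤ j) (hk : 1 ≤ k) :
    R1tt (BH (changes j k)) ⊆ PQuery (BH j) (BH k) := by
  rintro L ⟨C, hC, f, hf, hL⟩
  obtain ⟨c, hc, hcm, rfl⟩ := (mem_BH_iff (by simp only [changes]; split_ifs <;> omega)).mp hC
  have hf' : PT id fun x => encTT (f x) := polyTime_iff_PT.mp hf
  have h₀ : PT id fun x => [(f x).2 false] := by
    simpa [encTT] using hf'.head? (some true)
  have h₁ : PT id fun x => [(f x).2 true] := by
    simpa [encTT] using hf'.tail.head? (some true)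
  have h₂ : PT id fun x => (f x).1 := by simpa [encTT] using hf'.tail.tail
  have hd : NPCount fun x => if xor ((f x).2 false) ((f x).2 true) then c (f x).1 else 0 :=
    (hc.preimage h₂).ite (NPCount.const 0) (h₀.bool₂ h₁ xor)
  obtain ⟨A, hA, B, hB, hAB⟩ := exists_queries hj hk hd (fun x => by
    split_ifs
    exacts [hcm _, Nat.zero_le _])
  obtain ⟨M, hM, h⟩ := OracleTM.exists_twoQuery h₀
  refine ⟨M, hM, A, hA, B, hB, ?_⟩
  ext x
  obtain ⟨p, hp⟩ := hM
  obtain ⟨c', _, _, hc', -⟩ := hp A B x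
  rw [mem_language_iff ⟨_, hc'⟩, (h A B x c' ⟨_, hc'⟩).2, hAB, hL, chi_odd]
  cases e₀ : (f x).2 false <;> cases e₁ : (f x).2 true <;> cases e₂ : odd (c (f x).1) <;>
    simp_all [odd]

theorem R1tt_PQueryPlus {j k : ℕ} (hj : 1 ≤ j) (hk : 1 ≤ k) :
    R1tt (PQueryPlus (BH j) (BH k)) = R1tt (BH (changes j k)) := by
  rw [(PQueryPlus_subset_BH hj hk).antisymm (BH_subset_PQueryPlus hj hk)]

/-- Under `h`, an odd `j + k` forces `j` even and `k` odd, precisely when `PQuery_subset_R1tt` also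
saves a change. -/
theorem R1tt_BH_changes {j k : ℕ} (hj : 1 ≤ j) (hk : 1 ≤ k) (h : ¬ (Odd j ∧ Even k)) :
    R1tt (BH (changes j k)) = PQuery (BH j) (BH k) := by
  refine (R1tt_subset_PQuery hj hk).antisymm (PQuery_subset_R1tt hj hk ?_)
  simp only [changes, Nat.odd_iff, Nat.even_iff] at *
  split_ifs <;> omega

end QueryOrder

theorem corollary3p7 (j k : ℕ) (hj : 1 ≤ j) (hk : 1 ≤ k) :
    (Odd j → Even k → 2 ≤ j →
      QueryOrder.R1tt (QueryOrder.PQueryPlus (QueryOrder.BH j) (QueryOrder.BH k)) =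
        QueryOrder.PQuery (QueryOrder.BH (j - 1)) (QueryOrder.BH k)) ∧
    (¬ (Odd j ∧ Even k) →
      QueryOrder.R1tt (QueryOrder.PQueryPlus (QueryOrder.BH j) (QueryOrder.BH k)) =
        QueryOrder.PQuery (QueryOrder.BH j) (QueryOrder.BH k)) := by
  refine ⟨fun hjo hke hj₂ => ?_, fun h => ?_⟩
  -- Both sides are `j + 2 * k - 1`: on the right `j - 1` and `k` are even, so nothing is
  -- subtracted.
  · have e : QueryOrder.changes j k = QueryOrder.changes (j - 1) k := by
      simp only [QueryOrder.changes, Nat.odd_iff, Nat.even_iff] at *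
      split_ifs <;> omega
    rw [QueryOrder.R1tt_PQueryPlus hj hk, e, QueryOrder.R1tt_BH_changes (by omega) hk]
    simp only [Nat.odd_iff, Nat.even_iff] at *
    omega
  · rw [QueryOrder.R1tt_PQueryPlus hj hk, QueryOrder.R1tt_BH_changes hj hk h]
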